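/- **Proposition.** Let $\mathbb N$ be the set of positive integers and let $f:\mathbb N\to\mathbb N$ be the Collatz map, $f(n)=3n+1$ for $n$ odd and $f(n)=n/2$ for $n$ even. Put $$N_1=\{n\in\mathbb N : n\equiv 1,5 \pmod 6\},\qquad N_2=f(N_1)=\{n\in\mathbb N : n\equiv 4,16 \pmod{18}\},$$ and let $P: N_1\cup N_2\to N_1\cup N_2$ be the first-return map of $f$ on $N_1\cup N_2$, that is, $P(n)=f^{\tau(n)}(n)$, where $\tau(n)$ is the least positive integer $k$ with $f^k(n)\in N_1\cup N_2$ (such a $k$ exists for every $n\in N_1\cup N_2$). Let $\mathcal H$ be a complex Hilbert space with a complete orthonormal system $\{e_n\}_{n\in N_1\cup N_2}$, let $T_1,T_2$ be the bounded operators on $\mathcal H$ with $$T_1e_n=\begin{cases}e_{P(n)},& n\in N_1,\\ 0,& n\in N_2,\end{cases}\qquad T_2e_n=\begin{cases}0,& n\in N_1,\\ e_{P(n)},& n\in N_2,\end{cases}$$ and put $S_1=T_1^*T_2^*$ and $S_2=T_2^*$. For operators $A,B$ on $\mathcal H$ let $C^*(A,B)$ denote the norm closure of the (not necessarily unital) $*$-algebra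 generated by $A$ and $B$. Then 1. $C^*(S_1,S_2)=C^*(T_1,T_2)$; 2. $S_1$ and $S_2$ are isometries satisfying the Cuntz relations $S_i^*S_j=\delta_{i,j}I$ for $i,j\in\{1,2\}$ and $S_1S_1^*+S_2S_2^*=I$; 3. $C^*(S_1,S_2)$ is $*$-isomorphic to the Cuntz algebra $\mathcal O_2$, the universal unital $C^*$-algebra generated by two isometries $s_1,s_2$ with $s_i^*s_j=\delta_{i,j}1$ and $s_1s_1^*+s_2s_2^*=1$. -/

import Mathlib

universe u v

noncomputable section

open scoped ENNReal

/-! ### First-return maps -/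

namespace FirstReturn

variable {X : Type*}

/-- The points of `Sig` that come back to `Sig` under some positive iterate of `f`. -/
def domain (f : X → X) (Sig : Set X) : Set X :=
  {x | x ∈ Sig ∧ ∃ k : ℕ, 0 < k ∧ f^[k] x ∈ Sig}

open scoped Classical in
/-- The minimal positive `k` with `f^[k] x ∈ Sig`. -/
def time (f : X → X) (Sig : Set X) (x : domain f Sig) : ℕ :=
  Nat.find x.2.2

/-- The first-return (Poincaré) map `x ↦ f^[time x] x` from its domain to `Sig`. -/
def map (f : X → X) (Sig : Set X) (x : domain f Sig) : Sig :=
  ⟨f^[time f Sig x] x, by classical exact (Nat.find_spec x.2.2).2⟩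

theorem time_pos (f : X → X) (Sig : Set X) (x : domain f Sig) : 0 < time f Sig x := by
  classical exact (Nat.find_spec x.2.2).1

theorem time_le (f : X → X) (Sig : Set X) (x : domain f Sig) {k : ℕ} (hk : 0 < k)
    (h : f^[k] x ∈ Sig) : time f Sig x ≤ k := by
  classical exact Nat.find_min' x.2.2 ⟨hk, h⟩

end FirstReturn

/-! ### The Collatz map and the first-return map `P` -/

namespace Collatz

/-- The Collatz map on the positive integers. -/
def f (n : ℕ+) : ℕ+ :=
  if h : Odd (n : ℕ) then 3 * n + 1
  else ⟨(n : ℕ) / 2, by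
    have := n.pos
    rw [Nat.not_odd_iff_even] at h
    obtain ⟨k, hk⟩ := h
    omega⟩

theorem f_odd {n : ℕ+} (h : Odd (n : ℕ)) : f n = 3 * n + 1 := by
  simp [f, h]

theorem coe_f_even {n : ℕ+} (h : Even (n : ℕ)) : (f n : ℕ) = n / 2 := by
  have h' : ¬ Odd (n : ℕ) := by simpa using h
  simp [f, h']

/-- The positive integers congruent to `1` or `5` modulo `6`. -/
def N₁ : Set ℕ+ := {n | (n : ℕ) % 6 = 1 ∨ (n : ℕ) % 6 = 5}

/-- The image of `N₁` under the Collatz map. -/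
def N₂ : Set ℕ+ := f '' N₁

theorem odd_of_mem_N₁ {n : ℕ+} (h : n ∈ N₁) : Odd (n : ℕ) := by
  rw [Nat.odd_iff]
  rcases h with h | h <;> omega

theorem mem_N₂ {n : ℕ+} : n ∈ N₂ ↔ (n : ℕ) % 18 = 4 ∨ (n : ℕ) % 18 = 16 := by
  constructor
  · rintro ⟨m, hm, rfl⟩
    rw [f_odd (odd_of_mem_N₁ hm)]
    push_cast
    rcases hm with h | h <;> omega
  · intro h
    have hn := n.pos
    refine ⟨⟨((n : ℕ) - 1) / 3, by omega⟩, ?_, ?_⟩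
    · change ((n : ℕ) - 1) / 3 % 6 = 1 ∨ ((n : ℕ) - 1) / 3 % 6 = 5
      omega
    · have ho : Odd (((⟨((n : ℕ) - 1) / 3, by omega⟩ : ℕ+)) : ℕ) := by
        rw [Nat.odd_iff]
        change ((n : ℕ) - 1) / 3 % 2 = 1
        omega
      rw [f_odd ho]
      apply PNat.eq
      push_cast
      change 3 * (((n : ℕ) - 1) / 3) + 1 = n
      omega

theorem even_of_mem_N₂ {n : ℕ+} (h : n ∈ N₂) : Even (n : ℕ) := by
  rw [Nat.even_iff]
  rcases mem_N₂.1 h with h | h <;> omega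

theorem disjoint_N : Disjoint N₁ N₂ := by
  rw [Set.disjoint_left]
  intro n h1 h2
  exact (Nat.not_odd_iff_even.2 (even_of_mem_N₂ h2)) (odd_of_mem_N₁ h1)

/-- The section `N₁ ∪ N₂`. -/
def Sec : Set ℕ+ := N₁ ∪ N₂

/-- As long as the number is divisible by `2 ^ k`, iterating `k` times divides by `2 ^ k`. -/
theorem iterate_mul_two_pow (k : ℕ) : ∀ n m : ℕ+, (n : ℕ) = 2 ^ k * m → f^[k] n = m := by
  induction k with
  | zero => intro n m h; exact PNat.eq (by simpa using h)
  | succ k ih =>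
    intro n m h
    rw [Function.iterate_succ_apply]
    apply ih
    have he : (n : ℕ) = 2 * (2 ^ k * m) := by rw [h]; ring
    rw [coe_f_even (by rw [he]; exact even_two_mul _), he]
    omega

/-- A number of `N₂` is `2 ^ k` times an element of `N₁`, with `k > 0`. -/
theorem exists_two_pow {n : ℕ+} (h : n ∈ N₂) :
    ∃ k : ℕ, 0 < k ∧ ∃ m : ℕ+, m ∈ N₁ ∧ (n : ℕ) = 2 ^ k * m := by
  obtain ⟨k, m, hm, hn⟩ := Nat.exists_eq_two_pow_mul_odd n.ne_zero
  have hm0 : 0 < m := hm.pos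
  have h3 : ¬ (3 ∣ m) := by
    intro hd
    have : 3 ∣ (n : ℕ) := by rw [hn]; exact Dvd.dvd.mul_left hd _
    rcases mem_N₂.1 h with h | h <;> omega
  refine ⟨k, ?_, ⟨m, hm0⟩, ?_, hn⟩
  · rcases Nat.eq_zero_or_pos k with rfl | hk
    · have := even_of_mem_N₂ h
      rw [hn, pow_zero, one_mul] at this
      exact absurd hm (Nat.not_odd_iff_even.2 this)
    · exact hk
  · change m % 6 = 1 ∨ m % 6 = 5
    rw [Nat.odd_iff] at hm
    omega

/-- Every point of the section returns to it, so that `P` is defined on the whole section. -/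
theorem mem_domain (n : Sec) : (n : ℕ+) ∈ FirstReturn.domain f Sec := by
  refine ⟨n.2, ?_⟩
  rcases n.2 with h | h
  · exact ⟨1, one_pos, Or.inr ⟨n, h, rfl⟩⟩
  · obtain ⟨k, hk, m, hm, he⟩ := exists_two_pow h
    refine ⟨k, hk, ?_⟩
    rw [iterate_mul_two_pow k _ m he]
    exact Or.inl hm

/-- The first-return map for the Collatz map on `N₁ ∪ N₂`. -/
def P (n : Sec) : Sec := FirstReturn.map f Sec ⟨n, mem_domain n⟩

theorem P_of_mem_N₁ {n : Sec} (h : (n : ℕ+) ∈ N₁) : (P n : ℕ+) = 3 * n + 1 := by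
  have h1 : FirstReturn.time f Sec ⟨n, mem_domain n⟩ = 1 :=
    le_antisymm (FirstReturn.time_le _ _ _ one_pos (Or.inr ⟨n, h, rfl⟩))
      (FirstReturn.time_pos _ _ _)
  change f^[FirstReturn.time f Sec ⟨n, mem_domain n⟩] (n : ℕ+) = _
  rw [h1, Function.iterate_one, f_odd (odd_of_mem_N₁ h)]

theorem P_of_mem_N₂ {n : Sec} (h : (n : ℕ+) ∈ N₂) :
    ((n : ℕ+) : ℕ) = 2 ^ FirstReturn.time f Sec ⟨n, mem_domain n⟩ * (P n : ℕ+) := by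
  obtain ⟨k, hk, m, hm, he⟩ := exists_two_pow h
  set t := FirstReturn.time f Sec ⟨n, mem_domain n⟩ with ht
  have htk : t ≤ k := FirstReturn.time_le _ _ _ hk (by
    change f^[k] (n : ℕ+) ∈ Sec
    rw [iterate_mul_two_pow k _ m he]; exact Or.inl hm)
  have hk' : 2 ^ k = 2 ^ t * 2 ^ (k - t) := by rw [← pow_add]; congr 1; omega
  have hP : (P n : ℕ+) = 2 ^ (k - t) * m := by
    change f^[t] (n : ℕ+) = _
    apply iterate_mul_two_pow
    rw [he, hk']
    push_cast
    ring
  rw [hP, he, hk']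
  push_cast
  ring

theorem P_injOn_N₁ : Set.InjOn P {n : Sec | (n : ℕ+) ∈ N₁} := by
  intro m hm n hn h
  have h' : (3 * m + 1 : ℕ+) = 3 * n + 1 := by
    rw [← P_of_mem_N₁ hm, ← P_of_mem_N₁ hn, h]
  have h'' := congrArg (fun x : ℕ+ => (x : ℕ)) h'
  push_cast at h''
  exact Subtype.ext (PNat.eq (by omega))

theorem P_injOn_N₂ : Set.InjOn P {n : Sec | (n : ℕ+) ∈ N₂} := by
  have key : ∀ m n : Sec, (m : ℕ+) ∈ N₂ → (n : ℕ+) ∈ N₂ → P m = P n →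
      FirstReturn.time f Sec ⟨m, mem_domain m⟩ ≤ FirstReturn.time f Sec ⟨n, mem_domain n⟩ := by
    intro m n hm hn h
    by_contra! hlt
    have em := P_of_mem_N₂ hm
    have en := P_of_mem_N₂ hn
    rw [h] at em
    have hs : f^[FirstReturn.time f Sec ⟨m, mem_domain m⟩ -
        FirstReturn.time f Sec ⟨n, mem_domain n⟩] (m : ℕ+) = n := by
      apply iterate_mul_two_pow
      rw [em, en, ← mul_assoc, ← pow_add]
      congr 2
      omega
    have := FirstReturn.time_le f Sec ⟨m, mem_domain m⟩ (Nat.sub_pos_of_lt hlt)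
      (by rw [hs]; exact n.2)
    have := FirstReturn.time_pos f Sec ⟨n, mem_domain n⟩
    omega
  intro m hm n hn h
  have ht := le_antisymm (key m n hm hn h) (key n m hn hm h.symm)
  have em := P_of_mem_N₂ hm
  have en := P_of_mem_N₂ hn
  rw [h, ht, ← en] at em
  exact Subtype.ext (PNat.eq em)

end Collatz

/-! ### Operators given by partial injections of an orthonormal basis -/

namespace BasisOp

variable {H : Type*} [NormedAddCommGroup H] [InnerProductSpace ℂ H] [CompleteSpace H]

/-- The isometry `ℓ²(κ) → H` that sends the standard basis to the orthonormal family `v`. -/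
def isom {κ : Type*} {v : κ → H} (hv : Orthonormal ℂ v) : lp (fun _ : κ => ℂ) 2 →L[ℂ] H :=
  (hv.orthogonalFamily.linearIsometry).toContinuousLinearMap

theorem isom_single {κ : Type*} [DecidableEq κ] {v : κ → H} (hv : Orthonormal ℂ v) (k : κ) :
    isom hv (lp.single 2 k 1) = v k := by
  change hv.orthogonalFamily.linearIsometry (lp.single 2 k 1) = v k
  rw [OrthogonalFamily.linearIsometry_apply_single]
  simp

variable {ι : Type*}

/-- For `g` injective on `D`, the bounded operator with `e n ↦ e (g n)` for `n ∈ D` and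
`e n ↦ 0` for `n ∉ D` (see `shift_apply`). -/
def shift (e : HilbertBasis ι ℂ H) (D : Set ι) (g : ι → ι) (hg : Set.InjOn g D) : H →L[ℂ] H :=
  isom (e.orthonormal.comp (fun n : D => g n) hg.injective) ∘L
    ContinuousLinearMap.adjoint
      (isom (e.orthonormal.comp (fun n : D => (n : ι)) Subtype.val_injective))

open scoped Classical in
theorem shift_apply (e : HilbertBasis ι ℂ H) (D : Set ι) (g : ι → ι) (hg : Set.InjOn g D)
    (n : ι) : shift e D g hg (e n) = if n ∈ D then e (g n) else 0 := by
  have hadj : ContinuousLinearMap.adjoint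
      (isom (e.orthonormal.comp (fun n : D => (n : ι)) Subtype.val_injective)) (e n) =
      if h : n ∈ D then lp.single 2 (⟨n, h⟩ : D) (1 : ℂ) else 0 := by
    ext k
    have h1 := lp.inner_single_left (𝕜 := ℂ) (G := fun _ : D => ℂ) k 1
      (ContinuousLinearMap.adjoint
        (isom (e.orthonormal.comp (fun n : D => (n : ι)) Subtype.val_injective)) (e n))
    rw [ContinuousLinearMap.adjoint_inner_right, isom_single] at h1
    have h2 := orthonormal_iff_ite.1 e.orthonormal (k : ι) n
    simp only [Function.comp_apply] at h1
    rw [h2] at h1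
    simp only [RCLike.inner_apply, map_one, mul_one] at h1
    rw [← h1]
    split_ifs with hkn hn hn
    · subst hkn; simp
    · exact absurd (hkn ▸ k.2) hn
    · rw [lp.single_apply_ne]
      · intro hh; exact hkn (congrArg Subtype.val hh)
    · simp
  rw [shift, ContinuousLinearMap.comp_apply, hadj]
  split_ifs with h
  · rw [isom_single]; rfl
  · simp

end BasisOp

/-! ### The operators `T₁, T₂, S₁, S₂` -/

namespace Collatz

variable {H : Type*} [NormedAddCommGroup H] [InnerProductSpace ℂ H] [CompleteSpace H]

/-- `T₁ e_n = e_{P n}` for `n ∈ N₁` and `T₁ e_n = 0` for `n ∈ N₂`. -/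
def T₁ (e : HilbertBasis Sec ℂ H) : H →L[ℂ] H :=
  BasisOp.shift e {n : Sec | (n : ℕ+) ∈ N₁} P P_injOn_N₁

/-- `T₂ e_n = 0` for `n ∈ N₁` and `T₂ e_n = e_{P n}` for `n ∈ N₂`. -/
def T₂ (e : HilbertBasis Sec ℂ H) : H →L[ℂ] H :=
  BasisOp.shift e {n : Sec | (n : ℕ+) ∈ N₂} P P_injOn_N₂

open scoped Classical in
theorem T₁_apply (e : HilbertBasis Sec ℂ H) (n : Sec) :
    T₁ e (e n) = if (n : ℕ+) ∈ N₁ then e (P n) else 0 :=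
  BasisOp.shift_apply e _ P P_injOn_N₁ n

open scoped Classical in
theorem T₂_apply (e : HilbertBasis Sec ℂ H) (n : Sec) :
    T₂ e (e n) = if (n : ℕ+) ∈ N₂ then e (P n) else 0 :=
  BasisOp.shift_apply e _ P P_injOn_N₂ n

/-- `S₁ = T₁* T₂*`. -/
def S₁ (e : HilbertBasis Sec ℂ H) : H →L[ℂ] H :=
  ContinuousLinearMap.adjoint (T₁ e) ∘L ContinuousLinearMap.adjoint (T₂ e)

/-- `S₂ = T₂*`. -/
def S₂ (e : HilbertBasis Sec ℂ H) : H →L[ℂ] H :=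
  ContinuousLinearMap.adjoint (T₂ e)

end Collatz

/-- The C*-algebra `C*(s)` generated by a set `s` of bounded operators: the norm closure of the
(not necessarily unital) *-algebra generated by `s`. -/
def cstarGenerated {H : Type*} [NormedAddCommGroup H] [InnerProductSpace ℂ H] [CompleteSpace H]
    (s : Set (H →L[ℂ] H)) : NonUnitalStarSubalgebra ℂ (H →L[ℂ] H) :=
  (NonUnitalStarAlgebra.adjoin ℂ s).topologicalClosure

/-! ### The Cuntz algebras -/

/-- The Cuntz relations: `sᵢ* sⱼ = δᵢⱼ 1` (in particular each `sᵢ` is an isometry) and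
`∑ᵢ sᵢ sᵢ* = 1`. -/
structure IsCuntzFamily {A : Type*} [Semiring A] [StarRing A] {n : ℕ} (s : Fin n → A) : Prop where
  star_mul : ∀ i j, star (s i) * s j = if i = j then 1 else 0
  sum_mul_star : ∑ i, s i * star (s i) = 1

theorem IsCuntzFamily.norm_le_one {A : Type*} [CStarAlgebra A] [Nontrivial A] {n : ℕ}
    {s : Fin n → A} (h : IsCuntzFamily s) (i : Fin n) : ‖s i‖ ≤ 1 := by
  have h1 : ‖s i‖ * ‖s i‖ = 1 := by
    rw [← CStarRing.norm_star_mul_self, h.star_mul, if_pos rfl, norm_one]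
  nlinarith [norm_nonneg (s i)]

/-- A realization of the Cuntz relations in a nonzero unital C*-algebra. -/
structure CuntzRealization (n : ℕ) : Type (u + 1) where
  carrier : Type u
  [cstarAlgebra : CStarAlgebra carrier]
  [nontrivial : Nontrivial carrier]
  gen : Fin n → carrier
  isCuntzFamily : IsCuntzFamily gen

attribute [instance] CuntzRealization.cstarAlgebra CuntzRealization.nontrivial

/-- The C*-algebra of norm-bounded families over all realizations of the Cuntz relations. -/
abbrev CuntzProduct (n : ℕ) : Type (u + 1) :=
  lp (fun ρ : CuntzRealization.{u} n => ρ.carrier) ∞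

instance (n : ℕ) : CStarAlgebra (CuntzProduct.{u} n) where

/-- The family of all the `i`-th generators of the realizations. -/
def cuntzProductGen (n : ℕ) (i : Fin n) : CuntzProduct.{u} n :=
  ⟨fun ρ => ρ.gen i, memℓp_infty ⟨1, by
    rintro _ ⟨ρ, rfl⟩
    exact ρ.isCuntzFamily.norm_le_one i⟩⟩

/-- The Cuntz algebra `𝓞ₙ` (for `n ≥ 2`): the universal unital C*-algebra generated by isometries
`s₁, …, sₙ` with `∑ᵢ sᵢ sᵢ* = 1` and `sᵢ* sⱼ = δᵢⱼ 1`. It is built in the usual way, as the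
C*-algebra generated by the simultaneous realization of the generators in all unital C*-algebras
(of a universe) that contain such isometries; `CuntzAlgebra.isCuntzFamily_gen`,
`CuntzAlgebra.adjoin_gen` and `CuntzAlgebra.existsUnique_lift` are its defining properties. -/
abbrev CuntzAlgebra (n : ℕ) : StarSubalgebra ℂ (CuntzProduct.{u} n) :=
  (StarAlgebra.adjoin ℂ (Set.range (cuntzProductGen.{u} n))).topologicalClosure

namespace CuntzAlgebra

instance (n : ℕ) : CStarAlgebra (CuntzAlgebra.{u} n) :=
  StarSubalgebra.cstarAlgebra _ (h_closed := StarSubalgebra.isClosed_topologicalClosure _)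

/-- The canonical generators of `𝓞ₙ`. -/
def gen (n : ℕ) (i : Fin n) : CuntzAlgebra.{u} n :=
  ⟨cuntzProductGen n i, StarSubalgebra.le_topologicalClosure _
    (StarAlgebra.subset_adjoin ℂ _ ⟨i, rfl⟩)⟩

theorem isCuntzFamily_gen (n : ℕ) : IsCuntzFamily (gen.{u} n) where
  star_mul i j := by
    apply Subtype.ext
    apply lp.ext
    funext ρ
    have h := ρ.isCuntzFamily.star_mul i j
    change star (ρ.gen i) * ρ.gen j = _
    rw [h]
    split_ifs <;> rfl
  sum_mul_star := by
    apply Subtype.ext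
    apply lp.ext
    funext ρ
    rw [AddSubmonoidClass.coe_finsetSum, lp.coeFn_sum, Finset.sum_apply]
    exact ρ.isCuntzFamily.sum_mul_star

/-- The canonical generators generate `𝓞ₙ` as a C*-algebra. -/
theorem adjoin_gen (n : ℕ) :
    (StarAlgebra.adjoin ℂ (Set.range (gen.{u} n))).topologicalClosure = ⊤ := by
  have hmap : (StarAlgebra.adjoin ℂ (Set.range (gen.{u} n))).map
      (CuntzAlgebra.{u} n).subtype =
      StarAlgebra.adjoin ℂ (Set.range (cuntzProductGen.{u} n)) := by
    rw [StarAlgHom.map_adjoin, ← Set.range_comp]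
    rfl
  rw [eq_top_iff]
  rintro ⟨x, hx⟩ -
  change _ ∈ closure _
  rw [Topology.IsInducing.subtypeVal.closure_eq_preimage_closure_image]
  change x ∈ closure _
  have hset : (Subtype.val '' (StarAlgebra.adjoin ℂ (Set.range (gen.{u} n)) :
      Set (CuntzAlgebra.{u} n))) =
      (StarAlgebra.adjoin ℂ (Set.range (cuntzProductGen.{u} n)) : Set _) := by
    rw [← hmap]
    rfl
  exact (congrArg (fun S => x ∈ closure S) hset).mpr hx

open scoped CStarAlgebra in
/-- Two *-homomorphisms on `𝓞ₙ` that agree on the generators are equal. -/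
theorem hom_ext {n : ℕ} {B : Type v} [CStarAlgebra B] {φ ψ : CuntzAlgebra.{u} n →⋆ₐ[ℂ] B}
    (h : ∀ i, φ (gen n i) = ψ (gen n i)) : φ = ψ := by
  have hφ : Continuous φ := map_continuous φ
  have hψ : Continuous ψ := map_continuous ψ
  have hle : (StarAlgebra.adjoin ℂ (Set.range (gen.{u} n))).topologicalClosure ≤
      StarAlgHom.equalizer φ ψ := by
    apply StarSubalgebra.topologicalClosure_minimal
    · rw [StarAlgebra.adjoin_le_iff]
      rintro _ ⟨i, rfl⟩
      exact h i
    · exact isClosed_eq hφ hψ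
  rw [adjoin_gen] at hle
  exact StarAlgHom.ext fun x => hle (StarSubalgebra.mem_top (x := x))

/-- Evaluation of a bounded family at one realization. -/
def eval {n : ℕ} (ρ : CuntzRealization.{u} n) : CuntzProduct.{u} n →⋆ₐ[ℂ] ρ.carrier where
  toFun x := x ρ
  map_one' := rfl
  map_mul' _ _ := rfl
  map_zero' := rfl
  map_add' _ _ := rfl
  commutes' _ := rfl
  map_star' _ := rfl

/-- The universal property of `𝓞ₙ`. -/
theorem existsUnique_lift {n : ℕ} {B : Type u} [CStarAlgebra B] {s : Fin n → B}
    (hs : IsCuntzFamily s) :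
    ∃! φ : CuntzAlgebra.{u} n →⋆ₐ[ℂ] B, ∀ i, φ (gen n i) = s i := by
  have hex : ∃ φ : CuntzAlgebra.{u} n →⋆ₐ[ℂ] B, ∀ i, φ (gen n i) = s i := by
    rcases subsingleton_or_nontrivial B with hB | hB
    · exact ⟨{
        toFun := fun _ => 0
        map_one' := Subsingleton.elim _ _
        map_mul' := fun _ _ => Subsingleton.elim _ _
        map_zero' := Subsingleton.elim _ _
        map_add' := fun _ _ => Subsingleton.elim _ _
        commutes' := fun _ => Subsingleton.elim _ _
        map_star' := fun _ => Subsingleton.elim _ _ }, fun _ => Subsingleton.elim _ _⟩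
    · exact ⟨(eval ⟨B, s, hs⟩).comp (CuntzAlgebra.{u} n).subtype, fun _ => rfl⟩
  obtain ⟨φ, hφ⟩ := hex
  exact ⟨φ, hφ, fun ψ hψ => hom_ext fun i => by rw [hψ, hφ]⟩

end CuntzAlgebra

end

/-! `P` maps `N₁` bijectively onto `N₂`, and maps `N₂` bijectively onto the whole section because 2
generates the units modulo 9 (`exists_P_eq`). Let `Q` be the projection onto the closed span of the
`e n` with `n ∈ N₂`. Then `T₂ T₂* = 1`, `T₂* T₂ = T₁ T₁* = Q` and `T₁* T₁ = 1 - Q`. The Cuntz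
relations for `S₁ = T₁* T₂*` and `S₂ = T₂*` follow algebraically, and `T₁ = S₂ S₁*`, `T₂ = S₂*`
recover the original operators.

The isomorphism with `𝓞₂` rests on simplicity (`injective_of_gauge`): a unital *-homomorphism `φ`
from `𝓞₂` to a nonzero C*-algebra is injective. On each finite-dimensional degree-zero span
`wordSpan s k k`, `φ` is injective, hence isometric. An isometry `w` compresses a polynomial `x` to
its degree-zero part (`exists_compression`), so that part has norm at most `‖φ x‖`. The same part is
the average of `x` under the gauge action over the `M`-th roots of unity, for large `M`. If `φ b =
0`, the averages of `b* b` are therefore arbitrarily small. By positivity the whole average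
dominates the terms on a short arc around 1, and these are close to `b* b` (`norm_le_gaugeAverage`);
hence `b = 0`. Finite averages replace both the integral over the circle and the faithful
conditional expectation.

The two C*-algebras are then compared through a Cuntz algebra of a larger universe that maps
injectively onto each. -/

noncomputable section

/-! ### Hilbert bases and adjoints of shifts -/

namespace HilbertBasis

variable {ι H : Type*} [NormedAddCommGroup H] [InnerProductSpace ℂ H]

/-- Bounded operators that agree on a Hilbert basis are equal. -/
theorem clm_ext (e : HilbertBasis ι ℂ H) {A B : H →L[ℂ] H} (h : ∀ i, A (e i) = B (e i)) :
    A = B := by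
  refine ContinuousLinearMap.ext_on (s := Set.range e) ?_ ?_
  · exact Submodule.dense_iff_topologicalClosure_eq_top.2 e.dense_span
  · rintro _ ⟨i, rfl⟩
    exact h i

/-- Vectors with the same inner products with a Hilbert basis are equal. -/
theorem ext_inner (e : HilbertBasis ι ℂ H) {x y : H} (h : ∀ i, inner ℂ (e i) x = inner ℂ (e i) y) :
    x = y := by
  apply e.repr.injective
  ext i
  rw [e.repr_apply_apply, e.repr_apply_apply, h]

end HilbertBasis

namespace BasisOp

variable {H : Type*} [NormedAddCommGroup H] [InnerProductSpace ℂ H] [CompleteSpace H] {ι : Type*}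

theorem adjoint_shift_apply_of_mem (e : HilbertBasis ι ℂ H) {D : Set ι} {g : ι → ι}
    (hg : Set.InjOn g D) {n : ι} (hn : n ∈ D) :
    ContinuousLinearMap.adjoint (shift e D g hg) (e (g n)) = e n := by
  classical
  apply e.ext_inner
  intro k
  rw [ContinuousLinearMap.adjoint_inner_right, shift_apply]
  have ho := orthonormal_iff_ite.1 e.orthonormal
  by_cases hk : k ∈ D
  · rw [if_pos hk, ho, ho]
    simp only [hg.eq_iff hk hn]
  · rw [if_neg hk, inner_zero_left, ho, if_neg]
    rintro rfl
    exact hk hn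

theorem adjoint_shift_apply_of_notMem (e : HilbertBasis ι ℂ H) {D : Set ι} {g : ι → ι}
    (hg : Set.InjOn g D) {m : ι} (hm : m ∉ g '' D) :
    ContinuousLinearMap.adjoint (shift e D g hg) (e m) = 0 := by
  classical
  apply e.ext_inner
  intro k
  rw [ContinuousLinearMap.adjoint_inner_right, shift_apply, inner_zero_right]
  by_cases hk : k ∈ D
  · rw [if_pos hk, orthonormal_iff_ite.1 e.orthonormal, if_neg]
    rintro rfl
    exact hm ⟨k, hk, rfl⟩
  · rw [if_neg hk, inner_zero_left]

end BasisOp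

/-! ### The first-return map and the relations between the operators -/

namespace Collatz

theorem not_dvd_of_mem_Sec {m : ℕ+} (h : m ∈ Sec) : ¬ 3 ∣ (m : ℕ) := by
  rcases h with h | h
  · rcases h with h | h <;> omega
  · rcases mem_N₂.1 h with h | h <;> omega

/-- Every element of the section is obtained from `N₂` by the first-return map. -/
theorem exists_P_eq (m : Sec) : ∃ n : Sec, (n : ℕ+) ∈ N₂ ∧ P n = m := by
  classical
  have hex : ∃ k : ℕ, 0 < k ∧ (2 ^ k * (m : ℕ+) : ℕ+) ∈ N₂ := by
    have h3 := not_dvd_of_mem_Sec m.2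
    -- The powers of 2 run through all units modulo 9, so some even `2 ^ k * m` is 4 or 7 modulo 9,
    -- that is, 4 or 16 modulo 18.
    have key : ∃ k : ℕ, 0 < k ∧
        (2 ^ k * ((m : ℕ+) : ℕ) % 18 = 4 ∨ 2 ^ k * ((m : ℕ+) : ℕ) % 18 = 16) := by
      have h9 : ((m : ℕ+) : ℕ) % 9 = 1 ∨ ((m : ℕ+) : ℕ) % 9 = 2 ∨ ((m : ℕ+) : ℕ) % 9 = 4 ∨
        ((m : ℕ+) : ℕ) % 9 = 5 ∨ ((m : ℕ+) : ℕ) % 9 = 7 ∨ ((m : ℕ+) : ℕ) % 9 = 8 := by omega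
      rcases h9 with h | h | h | h | h | h
      · exact ⟨2, by omega, by omega⟩
      · exact ⟨1, by omega, by omega⟩
      · exact ⟨2, by omega, by omega⟩
      · exact ⟨3, by omega, by omega⟩
      · exact ⟨4, by omega, by omega⟩
      · exact ⟨1, by omega, by omega⟩
    obtain ⟨k, hk, h⟩ := key
    exact ⟨k, hk, mem_N₂.2 (by push_cast; exact h)⟩
  obtain ⟨hk, hn⟩ := Nat.find_spec hex
  set k := Nat.find hex with hkdef
  refine ⟨⟨2 ^ k * m, Or.inr hn⟩, hn, ?_⟩
  set n : Sec := ⟨2 ^ k * m, Or.inr hn⟩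
  have hret : ∀ j ≤ k, f^[j] (n : ℕ+) = 2 ^ (k - j) * m := by
    intro j hj
    apply iterate_mul_two_pow
    change ((2 ^ k * (m : ℕ+) : ℕ+) : ℕ) = _
    push_cast
    rw [← mul_assoc, ← pow_add, Nat.add_sub_cancel' hj]
  have hle : FirstReturn.time f Sec ⟨n, mem_domain n⟩ ≤ k := by
    refine FirstReturn.time_le _ _ _ hk ?_
    have := hret k le_rfl
    rw [Nat.sub_self, pow_zero, one_mul] at this
    exact this ▸ m.2
  have hP : (P n : ℕ+) = 2 ^ (k - FirstReturn.time f Sec ⟨n, mem_domain n⟩) * m := hret _ hle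
  have hpos := FirstReturn.time_pos f Sec ⟨n, mem_domain n⟩
  rcases hle.eq_or_lt with h | h
  · apply Subtype.ext
    rw [hP, h, Nat.sub_self, pow_zero, one_mul]
  -- An earlier return would be at an even number `2 ^ i * m` with `0 < i < k`: not in `N₁` by
  -- parity, not in `N₂` by minimality of `k`.
  · exfalso
    have hmem := (P n).2
    rw [hP] at hmem
    rcases hmem with h1 | h2
    · refine Nat.not_even_iff_odd.2 (odd_of_mem_N₁ h1) ?_
      push_cast
      exact (Nat.even_pow.2 ⟨even_two, by omega⟩).mul_right _
    · exact Nat.find_min hex (m := k - FirstReturn.time f Sec ⟨n, mem_domain n⟩)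
        (by omega) ⟨by omega, h2⟩

theorem P_mem_N₂ {n : Sec} (h : (n : ℕ+) ∈ N₁) : (P n : ℕ+) ∈ N₂ := by
  rw [P_of_mem_N₁ h, ← f_odd (odd_of_mem_N₁ h)]
  exact ⟨n, h, rfl⟩

theorem exists_P_eq_of_mem_N₂ {m : Sec} (h : (m : ℕ+) ∈ N₂) : ∃ n : Sec, (n : ℕ+) ∈ N₁ ∧ P n = m := by
  obtain ⟨n, hn, hnm⟩ := h
  refine ⟨⟨n, Or.inl hn⟩, hn, Subtype.ext ?_⟩
  rw [P_of_mem_N₁ (n := ⟨n, Or.inl hn⟩) hn, ← hnm, f_odd (odd_of_mem_N₁ hn)]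

theorem notMem_N₂ {n : Sec} (h : (n : ℕ+) ∈ N₁) : (n : ℕ+) ∉ N₂ :=
  Set.disjoint_left.1 disjoint_N h

variable {H : Type*} [NormedAddCommGroup H] [InnerProductSpace ℂ H] [CompleteSpace H]
  (e : HilbertBasis Sec ℂ H)

open ContinuousLinearMap (adjoint)

theorem adjoint_T₁_P {n : Sec} (hn : (n : ℕ+) ∈ N₁) : adjoint (T₁ e) (e (P n)) = e n :=
  BasisOp.adjoint_shift_apply_of_mem e P_injOn_N₁ hn

theorem adjoint_T₁_apply {m : Sec} (hm : (m : ℕ+) ∈ N₁) : adjoint (T₁ e) (e m) = 0 := by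
  apply BasisOp.adjoint_shift_apply_of_notMem
  rintro ⟨n, hn, rfl⟩
  exact notMem_N₂ hm (P_mem_N₂ hn)

theorem adjoint_T₂_P {n : Sec} (hn : (n : ℕ+) ∈ N₂) : adjoint (T₂ e) (e (P n)) = e n :=
  BasisOp.adjoint_shift_apply_of_mem e P_injOn_N₂ hn

theorem T₂_mul_star : T₂ e * star (T₂ e) = 1 := by
  classical
  refine e.clm_ext fun m => ?_
  obtain ⟨n, hn, rfl⟩ := exists_P_eq m
  change T₂ e (adjoint (T₂ e) _) = e (P n)
  rw [adjoint_T₂_P e hn, T₂_apply, if_pos hn]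

theorem star_T₂_mul_apply_of_mem_N₂ {m : Sec} (h : (m : ℕ+) ∈ N₂) :
    (star (T₂ e) * T₂ e) (e m) = e m := by
  classical
  change adjoint (T₂ e) (T₂ e _) = e m
  rw [T₂_apply, if_pos h, adjoint_T₂_P e h]

theorem star_T₂_mul_apply_of_mem_N₁ {m : Sec} (h : (m : ℕ+) ∈ N₁) :
    (star (T₂ e) * T₂ e) (e m) = 0 := by
  classical
  change adjoint (T₂ e) (T₂ e _) = 0
  rw [T₂_apply, if_neg (notMem_N₂ h), map_zero]

/-- Both sides are the projection `Q`: `N₂` is at once the image of `P` on `N₁` and the initial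
domain of `T₂`. -/
theorem T₁_mul_star : T₁ e * star (T₁ e) = star (T₂ e) * T₂ e := by
  classical
  refine e.clm_ext fun m => ?_
  rcases m.2 with hm | hm
  · rw [star_T₂_mul_apply_of_mem_N₁ e hm]
    change T₁ e (adjoint (T₁ e) _) = 0
    rw [adjoint_T₁_apply e hm, map_zero]
  · rw [star_T₂_mul_apply_of_mem_N₂ e hm]
    obtain ⟨n, hn, rfl⟩ := exists_P_eq_of_mem_N₂ hm
    change T₁ e (adjoint (T₁ e) _) = _
    rw [adjoint_T₁_P e hn, T₁_apply, if_pos hn]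

theorem star_mul_add_star_mul : star (T₁ e) * T₁ e + star (T₂ e) * T₂ e = 1 := by
  classical
  refine e.clm_ext fun m => ?_
  change (star (T₁ e) * T₁ e) (e m) + (star (T₂ e) * T₂ e) (e m) = e m
  change adjoint (T₁ e) (T₁ e _) + _ = _
  rcases m.2 with hm | hm
  · rw [star_T₂_mul_apply_of_mem_N₁ e hm, T₁_apply, if_pos hm, adjoint_T₁_P e hm, add_zero]
  · rw [star_T₂_mul_apply_of_mem_N₂ e hm, T₁_apply, if_neg fun h => notMem_N₂ h hm, map_zero,
      zero_add]

theorem T₁_mul_star_T₂_mul_T₂ : T₁ e * (star (T₂ e) * T₂ e) = 0 := by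
  classical
  refine e.clm_ext fun m => ?_
  change T₁ e ((star (T₂ e) * T₂ e) _) = 0
  rcases m.2 with hm | hm
  · rw [star_T₂_mul_apply_of_mem_N₁ e hm, map_zero]
  · rw [star_T₂_mul_apply_of_mem_N₂ e hm, T₁_apply, if_neg fun h => notMem_N₂ h hm]

/-- The range of `T₁*` is spanned by the `e n` with `n ∈ N₁`, which `T₂` kills. -/
theorem T₂_mul_star_T₁ : T₂ e * star (T₁ e) = 0 := by
  have h : star (T₂ e) * T₂ e * star (T₁ e) = 0 := by
    simpa [mul_assoc] using congrArg star (T₁_mul_star_T₂_mul_T₂ e)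
  calc T₂ e * star (T₁ e) = T₂ e * star (T₂ e) * T₂ e * star (T₁ e) := by
        rw [T₂_mul_star, one_mul]
    _ = T₂ e * (star (T₂ e) * T₂ e * star (T₁ e)) := by simp only [mul_assoc]
    _ = 0 := by rw [h, mul_zero]

theorem S₁_eq : S₁ e = star (T₁ e) * star (T₂ e) := rfl

theorem S₂_eq : S₂ e = star (T₂ e) := rfl

/-- The operators `S₁, S₂` satisfy the Cuntz relations. -/
theorem isCuntzFamily_S : IsCuntzFamily ![S₁ e, S₂ e] := by
  have h22 : star (S₂ e) * S₂ e = 1 := by rw [S₂_eq, star_star, T₂_mul_star]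
  have h21 : star (S₂ e) * S₁ e = 0 := by
    rw [S₂_eq, S₁_eq, star_star, ← mul_assoc, T₂_mul_star_T₁, zero_mul]
  have h12 : star (S₁ e) * S₂ e = 0 := by simpa using congrArg star h21
  have h11 : star (S₁ e) * S₁ e = 1 := by
    calc star (S₁ e) * S₁ e = T₂ e * (T₁ e * star (T₁ e)) * star (T₂ e) := by
          simp only [S₁_eq, star_mul, star_star, mul_assoc]
      _ = T₂ e * star (T₂ e) * (T₂ e * star (T₂ e)) := by
          rw [T₁_mul_star]; simp only [mul_assoc]
      _ = 1 := by rw [T₂_mul_star, one_mul]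
  constructor
  · intro i j
    fin_cases i <;> fin_cases j <;> simp [h11, h12, h21, h22]
  · rw [Fin.sum_univ_two]
    change S₁ e * star (S₁ e) + S₂ e * star (S₂ e) = 1
    -- This is `T₁ = Q T₁`, obtained from `T₁ T₁* T₁ = T₁ (1 - Q) = T₁`.
    have h : T₁ e = star (T₂ e) * T₂ e * T₁ e := by
      rw [← T₁_mul_star, mul_assoc, eq_sub_of_add_eq (star_mul_add_star_mul e), mul_sub, mul_one,
        T₁_mul_star_T₂_mul_T₂, sub_zero]
    calc S₁ e * star (S₁ e) + S₂ e * star (S₂ e)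
        = star (T₁ e) * (star (T₂ e) * T₂ e * T₁ e) + star (T₂ e) * T₂ e := by
          simp only [S₁_eq, S₂_eq, star_mul, star_star, mul_assoc]
      _ = 1 := by rw [← h, star_mul_add_star_mul]

theorem T₂_eq : T₂ e = star (S₂ e) := by rw [S₂_eq, star_star]

theorem T₁_eq : T₁ e = S₂ e * star (S₁ e) := by
  rw [S₁_eq, S₂_eq, star_mul, star_star, star_star, ← mul_assoc, ← T₁_mul_star, mul_assoc,
    eq_sub_of_add_eq (star_mul_add_star_mul e), mul_sub, mul_one, T₁_mul_star_T₂_mul_T₂, sub_zero]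

/-- Each pair consists of *-monomials in the other, so equality holds even before taking closures.
-/
theorem adjoin_S : NonUnitalStarAlgebra.adjoin ℂ {S₁ e, S₂ e} =
    NonUnitalStarAlgebra.adjoin ℂ {T₁ e, T₂ e} := by
  apply le_antisymm <;> apply NonUnitalStarAlgebra.adjoin_le
  · have h1 : T₁ e ∈ NonUnitalStarAlgebra.adjoin ℂ {T₁ e, T₂ e} :=
      NonUnitalStarAlgebra.subset_adjoin _ _ (by simp)
    have h2 : T₂ e ∈ NonUnitalStarAlgebra.adjoin ℂ {T₁ e, T₂ e} :=
      NonUnitalStarAlgebra.subset_adjoin _ _ (by simp)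
    rintro _ (rfl | rfl)
    · exact mul_mem (star_mem h1) (star_mem h2)
    · exact star_mem h2
  · have h1 : S₁ e ∈ NonUnitalStarAlgebra.adjoin ℂ {S₁ e, S₂ e} :=
      NonUnitalStarAlgebra.subset_adjoin _ _ (by simp)
    have h2 : S₂ e ∈ NonUnitalStarAlgebra.adjoin ℂ {S₁ e, S₂ e} :=
      NonUnitalStarAlgebra.subset_adjoin _ _ (by simp)
    rintro _ (rfl | rfl)
    · rw [T₁_eq]
      exact mul_mem h2 (star_mem h1)
    · rw [T₂_eq]
      exact star_mem h2

end Collatz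

theorem norm_apply_eq_of_star_mul_self {H : Type*} [NormedAddCommGroup H] [InnerProductSpace ℂ H]
    [CompleteSpace H] {A : H →L[ℂ] H} (h : star A * A = 1) (x : H) : ‖A x‖ = ‖x‖ :=
  (ContinuousLinearMap.norm_map_iff_adjoint_comp_self A).2 h x

/-! ### Algebra of the words `s_α s_β*` -/

namespace IsCuntzFamily

section Algebra

set_option linter.unusedSectionVars false

variable {A : Type*} [Ring A] [StarRing A] [Algebra ℂ A] [StarModule ℂ A] {n : ℕ} (s : Fin n → A)

/-- The span of the isometries of a family. -/
def genSpan : Submodule ℂ A := Submodule.span ℂ (Set.range s)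

/-- The span of the adjoints of the isometries of a family. -/
def starSpan : Submodule ℂ A := Submodule.span ℂ (Set.range fun i => star (s i))

/-- The span of the elements `s_α s_β*` with words `α`, `β` of lengths `j`, `k`. -/
def wordSpan (j k : ℕ) : Submodule ℂ A := genSpan s ^ j * starSpan s ^ k

variable {s}

theorem apply_mem_genSpan (i : Fin n) : s i ∈ genSpan s := Submodule.subset_span ⟨i, rfl⟩

theorem star_apply_mem_starSpan (i : Fin n) : star (s i) ∈ starSpan s :=
  Submodule.subset_span ⟨i, rfl⟩

theorem star_mem_starSpan {x : A} (hx : x ∈ genSpan s) : star x ∈ starSpan s := by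
  induction hx using Submodule.span_induction with
  | mem x hx => obtain ⟨i, rfl⟩ := hx; exact star_apply_mem_starSpan i
  | zero => rw [star_zero]; exact zero_mem _
  | add x y _ _ hx hy => rw [star_add]; exact add_mem hx hy
  | smul c x _ hx => rw [star_smul]; exact Submodule.smul_mem _ _ hx

theorem star_mem_genSpan {x : A} (hx : x ∈ starSpan s) : star x ∈ genSpan s := by
  induction hx using Submodule.span_induction with
  | mem x hx => obtain ⟨i, rfl⟩ := hx; rw [star_star]; exact apply_mem_genSpan i
  | zero => rw [star_zero]; exact zero_mem _
  | add x y _ _ hx hy => rw [star_add]; exact add_mem hx hy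
  | smul c x _ hx => rw [star_smul]; exact Submodule.smul_mem _ _ hx

theorem star_mem_pow {V W : Submodule ℂ A} (h : ∀ x ∈ V, star x ∈ W) (k : ℕ) :
    ∀ x ∈ V ^ k, star x ∈ W ^ k := by
  induction k with
  | zero =>
    intro x hx
    rw [pow_zero, Submodule.mem_one] at hx ⊢
    obtain ⟨c, rfl⟩ := hx
    exact ⟨star c, algebraMap_star_comm c⟩
  | succ k ih =>
    intro x hx
    rw [pow_succ] at hx
    induction hx using Submodule.mul_induction_on' with
    | mem_mul_mem x hx y hy =>
      rw [StarMul.star_mul, pow_succ']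
      exact Submodule.mul_mem_mul (h y hy) (ih x hx)
    | add x _ y _ hx hy => rw [star_add]; exact add_mem hx hy

theorem star_mem_wordSpan {j k : ℕ} {x : A} (hx : x ∈ wordSpan s j k) :
    star x ∈ wordSpan s k j := by
  induction hx using Submodule.mul_induction_on' with
  | mem_mul_mem x hx y hy =>
    rw [StarMul.star_mul]
    exact Submodule.mul_mem_mul (star_mem_pow (fun _ => star_mem_genSpan) k y hy)
      (star_mem_pow (fun _ => star_mem_starSpan) j x hx)
  | add x _ y _ hx hy => rw [star_add]; exact add_mem hx hy

theorem wordSpan_fg (j k : ℕ) : (wordSpan s j k).FG :=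
  ((Submodule.fg_span (Set.finite_range _)).pow j).mul ((Submodule.fg_span (Set.finite_range _)).pow k)

variable (h : IsCuntzFamily s)
include h

/-- With `one_le_genSpan_mul_starSpan`, this turns the Cuntz relations into two inclusions of
submodules; word manipulations become monotone calculations without indices. -/
theorem starSpan_mul_genSpan_le : starSpan s * genSpan s ≤ 1 := by
  rw [starSpan, genSpan, Submodule.span_mul_span, Submodule.span_le]
  rintro _ ⟨_, ⟨i, rfl⟩, _, ⟨j, rfl⟩, rfl⟩
  change star (s i) * s j ∈ (1 : Submodule ℂ A)
  rw [h.star_mul]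
  split_ifs
  · exact Submodule.one_le.1 le_rfl
  · exact zero_mem _

theorem one_le_genSpan_mul_starSpan : 1 ≤ genSpan s * starSpan s := by
  rw [Submodule.one_le, ← h.sum_mul_star]
  exact Submodule.sum_mem _ fun i _ =>
    Submodule.mul_mem_mul (apply_mem_genSpan i) (star_apply_mem_starSpan i)

theorem starSpan_pow_mul_genSpan_pow_le (k : ℕ) : starSpan s ^ k * genSpan s ^ k ≤ 1 := by
  induction k with
  | zero => simp
  | succ k ih =>
    calc starSpan s ^ (k + 1) * genSpan s ^ (k + 1)
        = starSpan s ^ k * (starSpan s * genSpan s) * genSpan s ^ k := by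
          rw [pow_succ, pow_succ']; simp only [mul_assoc]
      _ ≤ starSpan s ^ k * 1 * genSpan s ^ k := by
          gcongr; exact h.starSpan_mul_genSpan_le
      _ ≤ 1 := by rwa [mul_one]

theorem one_le_genSpan_pow_mul_starSpan_pow (k : ℕ) : 1 ≤ genSpan s ^ k * starSpan s ^ k := by
  induction k with
  | zero => simp
  | succ k ih =>
    calc 1 ≤ genSpan s ^ k * 1 * starSpan s ^ k := by rwa [mul_one]
      _ ≤ genSpan s ^ k * (genSpan s * starSpan s) * starSpan s ^ k := by
          gcongr; exact h.one_le_genSpan_mul_starSpan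
      _ = genSpan s ^ (k + 1) * starSpan s ^ (k + 1) := by
          rw [pow_succ, pow_succ']; simp only [mul_assoc]

/-- Inserting `1 = ∑ s_γ s_γ*` over words of length `l` lengthens both words and keeps the degree `j
- k`. -/
theorem wordSpan_le_add (j k l : ℕ) : wordSpan s j k ≤ wordSpan s (j + l) (k + l) := by
  calc wordSpan s j k = genSpan s ^ j * 1 * starSpan s ^ k := by rw [mul_one]; rfl
    _ ≤ genSpan s ^ j * (genSpan s ^ l * starSpan s ^ l) * starSpan s ^ k := by
        gcongr; exact h.one_le_genSpan_pow_mul_starSpan_pow l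
    _ = wordSpan s (j + l) (k + l) := by
        rw [wordSpan, add_comm k l, pow_add, pow_add]; simp only [mul_assoc]

theorem wordSpan_mul_le (j k l : ℕ) : wordSpan s j k * wordSpan s k l ≤ wordSpan s j l := by
  calc wordSpan s j k * wordSpan s k l
      = genSpan s ^ j * (starSpan s ^ k * genSpan s ^ k) * starSpan s ^ l := by
        simp only [wordSpan, mul_assoc]
    _ ≤ genSpan s ^ j * 1 * starSpan s ^ l := by
        gcongr; exact h.starSpan_pow_mul_genSpan_pow_le k
    _ = wordSpan s j l := by rw [mul_one]; rfl

theorem one_mem_wordSpan (k : ℕ) : (1 : A) ∈ wordSpan s k k :=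
  Submodule.one_le.1 (h.one_le_genSpan_pow_mul_starSpan_pow k)

/-- The spans of the elements `s_α s_β*` together contain the *-algebra generated by the family. -/
theorem mem_iSup_wordSpan {x : A} (hx : x ∈ StarAlgebra.adjoin ℂ (Set.range s)) :
    x ∈ ⨆ p : ℕ × ℕ, wordSpan s p.1 p.2 := by
  have hle : ∀ j k, wordSpan s j k ≤ ⨆ p : ℕ × ℕ, wordSpan s p.1 p.2 := fun j k =>
    le_iSup (fun p : ℕ × ℕ => wordSpan s p.1 p.2) (j, k)
  induction hx using StarAlgebra.adjoin_induction with
  | mem x hx =>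
    obtain ⟨i, rfl⟩ := hx
    refine hle 1 0 ?_
    rw [wordSpan, pow_one, pow_zero, mul_one]
    exact apply_mem_genSpan i
  | algebraMap c =>
    refine hle 0 0 ?_
    rw [wordSpan, pow_zero, pow_zero, mul_one]
    exact Submodule.mem_one.2 ⟨c, rfl⟩
  | add x y _ _ hx hy => exact add_mem hx hy
  | mul x y _ _ hx hy =>
    refine Set.mem_of_subset_of_mem ?_ (Submodule.mul_mem_mul hx hy)
    change (_ : Submodule ℂ A) ≤ _
    rw [Submodule.iSup_mul]
    refine iSup_le fun p => ?_
    rw [Submodule.mul_iSup]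
    refine iSup_le fun q => ?_
    -- Pad the factor with the shorter inner word until the inner lengths match; the inner words
    -- then contract to scalars.
    rcases le_total p.2 q.1 with hpq | hpq
    · calc wordSpan s p.1 p.2 * wordSpan s q.1 q.2
          ≤ wordSpan s (p.1 + (q.1 - p.2)) (p.2 + (q.1 - p.2)) * wordSpan s q.1 q.2 := by
            gcongr; exact h.wordSpan_le_add _ _ _
        _ ≤ _ := by
            rw [Nat.add_sub_cancel' hpq]; exact (h.wordSpan_mul_le _ _ _).trans (hle _ _)
    · calc wordSpan s p.1 p.2 * wordSpan s q.1 q.2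
          ≤ wordSpan s p.1 p.2 * wordSpan s (q.1 + (p.2 - q.1)) (q.2 + (p.2 - q.1)) := by
            gcongr; exact h.wordSpan_le_add _ _ _
        _ ≤ _ := by
            rw [Nat.add_sub_cancel' hpq]; exact (h.wordSpan_mul_le _ _ _).trans (hle _ _)
  | star x hx' hx =>
    clear hx'
    induction hx using Submodule.iSup_induction' with
    | mem p x hx => exact hle _ _ (star_mem_wordSpan hx)
    | zero => rw [star_zero]; exact zero_mem _
    | add x y _ _ hx hy => rw [star_add]; exact add_mem hx hy

/-- A homomorphism to a nontrivial algebra is injective on the span of the `s_α s_β*` with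
`α`, `β` of length `k`. -/
theorem eq_zero_of_map_eq_zero {B : Type*} [Ring B] [Nontrivial B] [Algebra ℂ B]
    (φ : A →ₐ[ℂ] B) {k : ℕ} {x : A} (hx : x ∈ wordSpan s k k) (h0 : φ x = 0) : x = 0 := by
  have hspan : Submodule.span ℂ {x} = ⊥ := by
    -- These products are the matrix entries of `x`: they are scalars killed by `φ`, and `φ` is
    -- injective on scalars.
    have hz : starSpan s ^ k * Submodule.span ℂ {x} * genSpan s ^ k ≤ ⊥ := by
      have hone : starSpan s ^ k * Submodule.span ℂ {x} * genSpan s ^ k ≤ 1 := by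
        calc starSpan s ^ k * Submodule.span ℂ {x} * genSpan s ^ k
            ≤ starSpan s ^ k * wordSpan s k k * genSpan s ^ k := by
              gcongr; exact (Submodule.span_singleton_le_iff_mem _ _).2 hx
          _ = (starSpan s ^ k * genSpan s ^ k) * (starSpan s ^ k * genSpan s ^ k) := by
              simp only [wordSpan, mul_assoc]
          _ ≤ 1 * 1 := mul_le_mul' (h.starSpan_pow_mul_genSpan_pow_le k)
              (h.starSpan_pow_mul_genSpan_pow_le k)
          _ = 1 := mul_one 1
      have hker : starSpan s ^ k * Submodule.span ℂ {x} * genSpan s ^ k ≤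
          LinearMap.ker φ.toLinearMap := by
        refine Submodule.mul_le.2 fun a ha b _ => ?_
        have ha' : starSpan s ^ k * Submodule.span ℂ {x} ≤ LinearMap.ker φ.toLinearMap := by
          refine Submodule.mul_le.2 fun c _ d hd => ?_
          obtain ⟨r, rfl⟩ := Submodule.mem_span_singleton.1 hd
          simp [h0]
        have := ha' ha
        simp only [LinearMap.mem_ker, AlgHom.toLinearMap_apply] at this ⊢
        rw [map_mul, this, zero_mul]
      intro y hy
      obtain ⟨c, rfl⟩ := Submodule.mem_one.1 (hone hy)
      have hc := hker hy
      simp only [LinearMap.mem_ker, AlgHom.toLinearMap_apply, AlgHom.commutes] at hc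
      rw [Submodule.mem_bot, (FaithfulSMul.algebraMap_injective ℂ B) (hc.trans (map_zero _).symm),
        map_zero]
    rw [eq_bot_iff]
    calc Submodule.span ℂ {x} = 1 * Submodule.span ℂ {x} * 1 := by rw [one_mul, mul_one]
      _ ≤ (genSpan s ^ k * starSpan s ^ k) * Submodule.span ℂ {x} *
          (genSpan s ^ k * starSpan s ^ k) := by
          gcongr <;> exact h.one_le_genSpan_pow_mul_starSpan_pow k
      _ = genSpan s ^ k * (starSpan s ^ k * Submodule.span ℂ {x} * genSpan s ^ k) *
          starSpan s ^ k := by simp only [mul_assoc]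
      _ ≤ genSpan s ^ k * ⊥ * starSpan s ^ k := by gcongr
      _ = ⊥ := by simp
  exact (Submodule.mem_bot ℂ).1 (hspan ▸ Submodule.mem_span_singleton_self x)

omit h in
variable (s) in
/-- The canonical endomorphism `x ↦ ∑ᵢ sᵢ x sᵢ*`. -/
def endo (x : A) : A := ∑ i, s i * x * star (s i)

omit h in
theorem star_endo (x : A) : star (endo s x) = endo s (star x) := by
  simp [endo, star_sum, mul_assoc]

omit h in
theorem star_iterate_endo (x : A) (N : ℕ) : star ((endo s)^[N] x) = (endo s)^[N] (star x) := by
  induction N generalizing x with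
  | zero => rfl
  | succ N ih => rw [Function.iterate_succ_apply, ih, star_endo, ← Function.iterate_succ_apply]

/-- Only the term `i = j` of the sum survives multiplication by `s j`. This lets an element be moved
past words. -/
theorem endo_mul_of_mem (u : A) {x : A} (hx : x ∈ genSpan s) : endo s u * x = x * u := by
  induction hx using Submodule.span_induction with
  | mem x hx =>
    obtain ⟨j, rfl⟩ := hx
    rw [endo, Finset.sum_mul, Finset.sum_eq_single j]
    · rw [mul_assoc, h.star_mul, if_pos rfl, mul_one]
    · intro i _ hij
      rw [mul_assoc, h.star_mul, if_neg hij, mul_zero]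
    · simp
  | zero => simp
  | add x y _ _ hx hy => rw [mul_add, add_mul, hx, hy]
  | smul c x _ hx => rw [mul_smul_comm, smul_mul_assoc, hx]

theorem iterate_endo_mul_of_mem (u : A) {N : ℕ} {x : A} (hx : x ∈ genSpan s ^ N) :
    (endo s)^[N] u * x = x * u := by
  induction N generalizing x with
  | zero =>
    rw [pow_zero, Submodule.mem_one] at hx
    obtain ⟨c, rfl⟩ := hx
    exact (Algebra.commutes c u).symm
  | succ N ih =>
    rw [pow_succ'] at hx
    induction hx using Submodule.mul_induction_on' with
    | mem_mul_mem x hx y hy =>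
      rw [Function.iterate_succ_apply', ← mul_assoc, h.endo_mul_of_mem _ hx, mul_assoc, ih hy,
        mul_assoc]
    | add x _ y _ hx hy => rw [mul_add, add_mul, hx, hy]

theorem mul_iterate_endo_of_mem (u : A) {N : ℕ} {x : A} (hx : x ∈ starSpan s ^ N) :
    x * (endo s)^[N] u = u * x := by
  have := congrArg star (h.iterate_endo_mul_of_mem (star u)
    (star_mem_pow (fun _ => star_mem_genSpan) N x hx))
  rwa [← star_iterate_endo, StarMul.star_mul, star_star, star_star, StarMul.star_mul, star_star,
    star_star] at this

theorem star_pow_mul_pow (i : Fin n) (k : ℕ) : star (s i) ^ k * s i ^ k = 1 := by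
  induction k with
  | zero => simp
  | succ k ih =>
    rw [pow_succ, pow_succ', mul_assoc, ← mul_assoc (star _) (s i), h.star_mul, if_pos rfl,
      one_mul, ih]

/-- The factor `star (s i₀) ^ d` contracts `m` to a scalar. What remains is a multiple of `star (s
i₁) * s i₀ ^ d * s i₁`, which vanishes since `i₀ ≠ i₁`. -/
theorem star_mul_mul_eq_zero {i₀ i₁ : Fin n} (hi : i₀ ≠ i₁) {d N : ℕ} (hd : 0 < d) (hdN : d ≤ N)
    {m : A} (hm : m ∈ genSpan s ^ d) :
    star (s i₀ ^ N * s i₁) * m * (s i₀ ^ N * s i₁) = 0 := by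
  have hc : star (s i₀) ^ d * m ∈ (1 : Submodule ℂ A) :=
    h.starSpan_pow_mul_genSpan_pow_le d (Submodule.mul_mem_mul
      (Submodule.pow_mem_pow _ (star_apply_mem_starSpan i₀) d) hm)
  obtain ⟨c, hc⟩ := Submodule.mem_one.1 hc
  obtain ⟨r, rfl⟩ := Nat.exists_eq_add_of_le' hdN
  obtain ⟨d, rfl⟩ := Nat.exists_eq_succ_of_ne_zero hd.ne'
  calc star (s i₀ ^ (r + (d + 1)) * s i₁) * m * (s i₀ ^ (r + (d + 1)) * s i₁)
      = star (s i₁) * star (s i₀) ^ r * (star (s i₀) ^ (d + 1) * m) *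
          (s i₀ ^ (r + (d + 1)) * s i₁) := by
        rw [StarMul.star_mul, star_pow, pow_add]; simp only [mul_assoc]
    _ = algebraMap ℂ A c * (star (s i₁) * (star (s i₀) ^ r * s i₀ ^ r) *
          (s i₀ ^ (d + 1) * s i₁)) := by
        rw [← hc, ← Algebra.commutes, pow_add]; simp only [mul_assoc]
    _ = algebraMap ℂ A c * (star (s i₁) * s i₀ * (s i₀ ^ d * s i₁)) := by
        rw [h.star_pow_mul_pow, mul_one, pow_succ']; simp only [mul_assoc]
    _ = 0 := by rw [h.star_mul, if_neg hi.symm, zero_mul, mul_zero]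

/-- The isometry that compresses polynomials in the generators to their part of degree zero. -/
theorem exists_compression {i₀ i₁ : Fin n} (hi : i₀ ≠ i₁) (N : ℕ) :
    ∃ w : A, (∀ x ∈ wordSpan s N N, star w * x * w = x) ∧
      ∀ j k, j ≠ k → j ≤ N → k ≤ N → ∀ x ∈ wordSpan s j k, star w * x * w = 0 := by
  set v := s i₀ ^ N * s i₁ with hv
  have hvv : star v * v = 1 := by
    rw [hv, StarMul.star_mul, star_pow, mul_assoc, ← mul_assoc (star (s i₀) ^ N),
      h.star_pow_mul_pow, one_mul, h.star_mul, if_pos rfl]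
  -- For words `p`, `q` of length `N`, this gives `w* (p m q*) w = p (v* m v) q*`, so compression by
  -- `w` acts only on the middle factor `m`.
  set w := (endo s)^[N] v with hw
  have hl : ∀ p ∈ genSpan s ^ N, star w * p = p * star v := fun p hp => by
    rw [hw, star_iterate_endo, h.iterate_endo_mul_of_mem _ hp]
  have hr : ∀ q ∈ starSpan s ^ N, q * w = v * q := fun q hq => h.mul_iterate_endo_of_mem _ hq
  have hgt : ∀ j k, k < j → j ≤ N → ∀ x ∈ wordSpan s j k, star w * x * w = 0 := by
    intro j k hkj hj x hx
    -- Padding by `N - k` gives outer words of length `N` and isolates the excess degree `j - k` in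
    -- the middle.
    have hx' : x ∈ genSpan s ^ N * (genSpan s ^ (j - k) * starSpan s ^ N) := by
      have := h.wordSpan_le_add j k (N - k) hx
      rw [wordSpan, show j + (N - k) = N + (j - k) by omega, show k + (N - k) = N by omega,
        pow_add, mul_assoc] at this
      exact this
    clear hx
    induction hx' using Submodule.mul_induction_on' with
    | mem_mul_mem p hp y hy =>
      induction hy using Submodule.mul_induction_on' with
      | mem_mul_mem m hm q hq =>
        calc star w * (p * (m * q)) * w = star w * p * m * (q * w) := by simp only [mul_assoc]
          _ = p * (star v * m * v) * q := by rw [hl p hp, hr q hq]; simp only [mul_assoc]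
          _ = 0 := by
            rw [hv, h.star_mul_mul_eq_zero hi (by omega) (by omega) hm, mul_zero, zero_mul]
      | add x _ y _ hx hy => rw [mul_add, mul_add, add_mul, hx, hy, add_zero]
    | add x _ y _ hx hy => rw [mul_add, add_mul, hx, hy, add_zero]
  refine ⟨w, fun x hx => ?_, fun j k hjk hj hk x hx => ?_⟩
  · induction hx using Submodule.mul_induction_on' with
    | mem_mul_mem p hp q hq =>
      calc star w * (p * q) * w = star w * p * (q * w) := by simp only [mul_assoc]
        _ = p * (star v * v) * q := by rw [hl p hp, hr q hq]; simp only [mul_assoc]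
        _ = p * q := by rw [hvv, mul_one]
    | add x _ y _ hx hy => rw [mul_add, add_mul, hx, hy]
  · rcases hjk.lt_or_gt with hlt | hlt
    · have := congrArg star (hgt k j hlt hk _ (star_mem_wordSpan hx))
      simpa [mul_assoc] using this
    · exact hgt j k hlt hj x hx

end Algebra

end IsCuntzFamily

/-! ### Norm estimates and gauge averages -/

namespace IsCuntzFamily

open Filter

section Norm

variable {A : Type*} [CStarAlgebra A] {n : ℕ} {s : Fin n → A}

/-- The finite-dimensional C*-subalgebra spanned by the `s_α s_β*` with `α`, `β` of length `k`. -/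
def core (h : IsCuntzFamily s) (k : ℕ) : StarSubalgebra ℂ A where
  carrier := wordSpan s k k
  mul_mem' ha hb := h.wordSpan_mul_le k k k (Submodule.mul_mem_mul ha hb)
  add_mem' := add_mem
  algebraMap_mem' c := by
    rw [Algebra.algebraMap_eq_smul_one]
    exact Submodule.smul_mem _ _ (h.one_mem_wordSpan k)
  star_mem' := star_mem_wordSpan

variable (h : IsCuntzFamily s)
include h

theorem isClosed_core (k : ℕ) : IsClosed (h.core k : Set A) := by
  have : FiniteDimensional ℂ (wordSpan s k k) := Module.Finite.iff_fg.2 (wordSpan_fg k k)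
  exact Submodule.closed_of_finiteDimensional (wordSpan s k k)

variable {B : Type*} [CStarAlgebra B] [Nontrivial B] (φ : A →⋆ₐ[ℂ] B)

/-- The finite-dimensional `core` is a C*-algebra on which `φ` is injective, and injective
*-homomorphisms are isometric. -/
theorem norm_map_of_mem_wordSpan {k : ℕ} {x : A} (hx : x ∈ wordSpan s k k) : ‖φ x‖ = ‖x‖ := by
  let : CStarAlgebra (h.core k) := StarSubalgebra.cstarAlgebra _ (h_closed := h.isClosed_core k)
  have hinj : Function.Injective (φ.comp (h.core k).subtype) := by
    refine (injective_iff_map_eq_zero _).2 fun y hy => ?_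
    exact Subtype.ext (h.eq_zero_of_map_eq_zero (φ : A →ₐ[ℂ] B) y.2 hy)
  exact NonUnitalStarAlgHom.norm_map (φ.comp (h.core k).subtype) hinj ⟨x, hx⟩

theorem norm_le_norm_map {N : ℕ} {w x y : A} (hw : ∀ x ∈ wordSpan s N N, star w * x * w = x)
    (hy : y ∈ wordSpan s N N) (hxy : star w * x * w = y) : ‖y‖ ≤ ‖φ x‖ := by
  have hw1 : ‖φ w‖ = 1 := by
    have h1 : star (φ w) * φ w = 1 := by
      have := hw 1 (h.one_mem_wordSpan N)
      rw [mul_one] at this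
      rw [← map_star, ← map_mul, this, map_one]
    have h2 : ‖φ w‖ * ‖φ w‖ = 1 := by rw [← CStarRing.norm_star_mul_self, h1, norm_one]
    nlinarith [norm_nonneg (φ w)]
  calc ‖y‖ = ‖star (φ w) * φ x * φ w‖ := by
        rw [← h.norm_map_of_mem_wordSpan φ hy, ← hxy, map_mul, map_mul, map_star]
    _ ≤ ‖star (φ w)‖ * ‖φ x‖ * ‖φ w‖ := norm_mul₃_le
    _ = ‖φ x‖ := by rw [norm_star, hw1, one_mul, mul_one]

end Norm

section Gauge

variable {A : Type*} [CStarAlgebra A] {n : ℕ} {s : Fin n → A} {ρ : Circle → A →⋆ₐ[ℂ] A}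

theorem map_eq_smul_of_mem_pow {V : Submodule ℂ A} {f : A →⋆ₐ[ℂ] A} {c : ℂ}
    (hV : ∀ x ∈ V, f x = c • x) (k : ℕ) : ∀ x ∈ V ^ k, f x = c ^ k • x := by
  induction k with
  | zero =>
    intro x hx
    rw [pow_zero, Submodule.mem_one] at hx
    obtain ⟨c, rfl⟩ := hx
    rw [pow_zero, one_smul]
    exact AlgHomClass.commutes f c
  | succ k ih =>
    intro x hx
    rw [pow_succ] at hx
    induction hx using Submodule.mul_induction_on' with
    | mem_mul_mem x hx y hy =>
      rw [map_mul, ih x hx, hV y hy, smul_mul_smul_comm, pow_succ]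
    | add x _ y _ hx hy => rw [map_add, hx, hy, smul_add]

theorem gauge_apply (hρ : ∀ z i, ρ z (s i) = (z : ℂ) • s i) (z : Circle) {j k : ℕ} {x : A}
    (hx : x ∈ wordSpan s j k) : ρ z x = ((z : ℂ) ^ j * (star (z : ℂ)) ^ k) • x := by
  have h1 : ∀ x ∈ genSpan s, ρ z x = (z : ℂ) • x := by
    intro x hx
    induction hx using Submodule.span_induction with
    | mem x hx => obtain ⟨i, rfl⟩ := hx; exact hρ z i
    | zero => simp
    | add x y _ _ hx hy => rw [map_add, hx, hy, smul_add]
    | smul c x _ hx => rw [map_smul, hx, smul_comm]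
  have h2 : ∀ x ∈ starSpan s, ρ z x = star (z : ℂ) • x := by
    intro x hx
    rw [← star_star x, map_star, h1 _ (star_mem_genSpan hx), star_smul]
  induction hx using Submodule.mul_induction_on' with
  | mem_mul_mem x hx y hy =>
    rw [map_mul, map_eq_smul_of_mem_pow h1 j x hx, map_eq_smul_of_mem_pow h2 k y hy,
      smul_mul_smul_comm]
  | add x _ y _ hx hy => rw [map_add, hx, hy, smul_add]

/-- Orbits of polynomials are trigonometric polynomials; since each `ρ z` is contractive,
approximating `a` approximates its orbit uniformly in `z`. -/
theorem continuous_gauge (hρ : ∀ z i, ρ z (s i) = (z : ℂ) • s i)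
    (hdense : Dense ((⨆ p : ℕ × ℕ, wordSpan s p.1 p.2 : Submodule ℂ A) : Set A)) (a : A) :
    Continuous fun z => ρ z a := by
  have hpoly : ∀ x ∈ (⨆ p : ℕ × ℕ, wordSpan s p.1 p.2), Continuous fun z => ρ z x := by
    intro x hx
    induction hx using Submodule.iSup_induction' with
    | mem p x hx =>
      simp only [fun z => gauge_apply hρ z hx]
      fun_prop
    | zero => simpa using continuous_const
    | add x y _ _ hx hy => simp only [map_add]; exact Continuous.add hx hy
  refine continuous_of_uniform_approx_of_continuous fun u hu => ?_
  obtain ⟨ε, hε, hu⟩ := Metric.mem_uniformity_dist.1 hu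
  obtain ⟨x, hx, hax⟩ := Metric.dense_iff.1 hdense a ε hε
  refine ⟨fun z => ρ z x, hpoly x hax, fun z => hu ?_⟩
  rw [dist_eq_norm, ← map_sub]
  refine (NonUnitalStarAlgHom.norm_apply_le (ρ z) _).trans_lt ?_
  rw [← dist_eq_norm, dist_comm]
  exact hx

/-- The `M`-th root of unity with smallest positive argument. -/
def rootOfUnity (M : ℕ) : Circle := Circle.exp (2 * Real.pi / M)

theorem isPrimitiveRoot_rootOfUnity {M : ℕ} (hM : M ≠ 0) :
    IsPrimitiveRoot (rootOfUnity M : ℂ) M := by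
  have := Complex.isPrimitiveRoot_exp M hM
  rw [rootOfUnity, Circle.coe_exp]
  convert this using 2
  push_cast
  ring

theorem sum_rootOfUnity_pow {M j k : ℕ} (hj : j < M) (hk : k < M) (hjk : j ≠ k) :
    ∑ i ∈ Finset.range M, (((rootOfUnity M ^ i : Circle) : ℂ) ^ j *
      star (((rootOfUnity M ^ i : Circle) : ℂ)) ^ k) = 0 := by
  have hp := isPrimitiveRoot_rootOfUnity (M := M) (by omega)
  set ζ : ℂ := (rootOfUnity M : ℂ) with hζ
  have hinv : star ζ = ζ⁻¹ := by rw [hζ, ← Circle.coe_inv, Circle.coe_inv_eq_conj]; rfl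
  have hζ0 : ζ ≠ 0 := Circle.coe_ne_zero _
  have hne : ζ ^ j * (ζ⁻¹) ^ k ≠ 1 := by
    intro h
    rw [inv_pow, ← div_eq_mul_inv, div_eq_one_iff_eq (pow_ne_zero _ hζ0)] at h
    exact hjk (hp.pow_inj hj hk h)
  have hpow : (ζ ^ j * (ζ⁻¹) ^ k) ^ M = 1 := by
    rw [mul_pow, ← pow_mul, ← pow_mul, mul_comm j, mul_comm k, pow_mul, pow_mul, inv_pow,
      hp.pow_eq_one]
    simp
  have hsum : ∑ i ∈ Finset.range M, (ζ ^ j * (ζ⁻¹) ^ k) ^ i = 0 := by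
    have := mul_geom_sum (ζ ^ j * (ζ⁻¹) ^ k) M
    rw [hpow, sub_self] at this
    exact (mul_eq_zero.1 this).resolve_left (sub_ne_zero.2 hne)
  rw [← hsum]
  refine Finset.sum_congr rfl fun i _ => ?_
  rw [Circle.coe_pow, star_pow, ← hζ, hinv, mul_pow]
  simp only [← pow_mul, mul_comm]

variable (ρ) in
/-- The average of a gauge action over the `M`-th roots of unity. -/
def gaugeAverage (M : ℕ) : A →ₗ[ℂ] A :=
  (M : ℂ)⁻¹ • ∑ i ∈ Finset.range M, (ρ (rootOfUnity M ^ i)).toAlgHom.toLinearMap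

theorem gaugeAverage_apply (M : ℕ) (x : A) :
    gaugeAverage ρ M x = (M : ℂ)⁻¹ • ∑ i ∈ Finset.range M, ρ (rootOfUnity M ^ i) x := by
  simp [gaugeAverage]

theorem norm_gaugeAverage_le (M : ℕ) (x : A) : ‖gaugeAverage ρ M x‖ ≤ ‖x‖ := by
  rcases Nat.eq_zero_or_pos M with rfl | hM
  · simp [gaugeAverage]
  have hM' : (0 : ℝ) < M := by exact_mod_cast hM
  rw [gaugeAverage_apply, norm_smul, norm_inv, Complex.norm_natCast, inv_mul_le_iff₀ hM']
  refine (norm_sum_le_of_le _ fun i _ => NonUnitalStarAlgHom.norm_apply_le _ x).trans ?_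
  simp

theorem gaugeAverage_of_mem (hρ : ∀ z i, ρ z (s i) = (z : ℂ) • s i) {M k : ℕ} (hM : 0 < M) {x : A}
    (hx : x ∈ wordSpan s k k) : gaugeAverage ρ M x = x := by
  have h1 : ∀ z, ρ z x = x := by
    intro z
    rw [gauge_apply hρ z hx, ← mul_pow]
    have : (z : ℂ) * star (z : ℂ) = 1 := by
      change (z : ℂ) * starRingEnd ℂ z = 1
      rw [Complex.mul_conj, Circle.normSq_coe, Complex.ofReal_one]
    rw [this, one_pow, one_smul]
  rw [gaugeAverage_apply]
  simp only [h1, Finset.sum_const, Finset.card_range]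
  rw [← Nat.cast_smul_eq_nsmul ℂ, smul_smul, inv_mul_cancel₀ (by exact_mod_cast hM.ne'), one_smul]

theorem gaugeAverage_eq_zero (hρ : ∀ z i, ρ z (s i) = (z : ℂ) • s i) {M j k : ℕ} (hj : j < M)
    (hk : k < M) (hjk : j ≠ k) {x : A} (hx : x ∈ wordSpan s j k) : gaugeAverage ρ M x = 0 := by
  rw [gaugeAverage_apply]
  simp only [fun z => gauge_apply hρ z hx]
  rw [← Finset.sum_smul, sum_rootOfUnity_pow hj hk hjk, zero_smul, smul_zero]

/-- On a polynomial in the generators, gauge averages are eventually bounded by the norm of the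
image under any unital homomorphism to a nonzero C*-algebra. -/
theorem eventually_norm_gaugeAverage_le (h : IsCuntzFamily s)
    (hρ : ∀ z i, ρ z (s i) = (z : ℂ) • s i) {i₀ i₁ : Fin n} (hi : i₀ ≠ i₁)
    {B : Type*} [CStarAlgebra B] [Nontrivial B] (φ : A →⋆ₐ[ℂ] B) {x : A}
    (hx : x ∈ ⨆ p : ℕ × ℕ, wordSpan s p.1 p.2) :
    ∀ᶠ M in atTop, ‖gaugeAverage ρ M x‖ ≤ ‖φ x‖ := by
  choose w hw hw0 using fun N => h.exists_compression hi N
  -- Here `y` is the degree-zero part of `x`; compression and averaging both produce it once `N`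
  -- exceeds all word lengths.
  have key : ∃ y, ∀ᶠ N in atTop,
      y ∈ wordSpan s N N ∧ star (w N) * x * w N = y ∧ gaugeAverage ρ N x = y := by
    induction hx using Submodule.iSup_induction' with
    | mem p x hx =>
      by_cases hp : p.1 = p.2
      · refine ⟨x, (eventually_gt_atTop p.1).mono fun N hN => ?_⟩
        rw [← hp] at hx
        have hxN : x ∈ wordSpan s N N := by
          have := h.wordSpan_le_add p.1 p.1 (N - p.1) hx
          rwa [Nat.add_sub_cancel' hN.le] at this
        exact ⟨hxN, hw N x hxN, gaugeAverage_of_mem hρ (by omega) hx⟩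
      · refine ⟨0, (eventually_gt_atTop (max p.1 p.2)).mono fun N hN => ?_⟩
        have h1 : p.1 < N := (le_max_left _ _).trans_lt hN
        have h2 : p.2 < N := (le_max_right _ _).trans_lt hN
        exact ⟨zero_mem _, hw0 N _ _ hp h1.le h2.le x hx, gaugeAverage_eq_zero hρ h1 h2 hp hx⟩
    | zero => exact ⟨0, Eventually.of_forall fun N => ⟨zero_mem _, by simp, map_zero _⟩⟩
    | add x y _ _ hx hy =>
      obtain ⟨x', hx⟩ := hx
      obtain ⟨y', hy⟩ := hy
      refine ⟨x' + y', ?_⟩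
      filter_upwards [hx, hy] with N hx hy
      exact ⟨add_mem hx.1 hy.1, by rw [mul_add, add_mul, hx.2.1, hy.2.1],
        by rw [map_add, hx.2.2, hy.2.2]⟩
  obtain ⟨y, hy⟩ := key
  filter_upwards [hy] with N hN
  rw [hN.2.2]
  exact h.norm_le_norm_map φ (hw N) hN.1 hN.2.1

open scoped CStarAlgebra in
/-- If the orbit of the positive element `b* b` varies by at most `η` on an arc, then its norm is
controlled by its gauge averages. -/
theorem norm_le_gaugeAverage {b : A} {η : ℝ} {L q : ℕ} (hL : 0 < L) (hq : 0 < q)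
    (hη : ∀ t : ℝ, 0 ≤ t → t < 2 * Real.pi / L →
      ‖star b * b - ρ (Circle.exp t) (star b * b)‖ ≤ η) :
    ‖star b * b‖ ≤ L * ‖gaugeAverage ρ (L * q) (star b * b)‖ + η := by
  let := CStarAlgebra.spectralOrder A
  let := CStarAlgebra.spectralOrderedRing A
  set a := star b * b with ha
  set M := L * q with hM
  have hq' : (0 : ℝ) < q := by exact_mod_cast hq
  have hL' : (0 : ℝ) < L := by exact_mod_cast hL
  have hM' : (M : ℂ) ≠ 0 := by exact_mod_cast (Nat.mul_pos hL hq).ne'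
  have hpos : ∀ i, 0 ≤ ρ (rootOfUnity M ^ i) a := by
    intro i
    rw [ha, map_mul, map_star]
    exact star_mul_self_nonneg _
  -- The first `q` of the `M = L * q` roots fill the arc of angles in `[0, 2π / L)`; the remaining
  -- terms are positive.
  have hmono : ‖∑ i ∈ Finset.range q, ρ (rootOfUnity M ^ i) a‖ ≤
      ‖∑ i ∈ Finset.range M, ρ (rootOfUnity M ^ i) a‖ := by
    refine CStarAlgebra.norm_le_norm_of_nonneg_of_le (Finset.sum_nonneg fun i _ => hpos i) ?_
    refine Finset.sum_le_sum_of_subset_of_nonneg ?_ fun i _ _ => hpos i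
    exact Finset.range_subset_range.2 (Nat.le_mul_of_pos_left q hL)
  have hsum : ∑ i ∈ Finset.range M, ρ (rootOfUnity M ^ i) a = (M : ℂ) • gaugeAverage ρ M a := by
    rw [gaugeAverage_apply, smul_smul, mul_inv_cancel₀ hM', one_smul]
  have hdiff : ‖∑ i ∈ Finset.range q, (a - ρ (rootOfUnity M ^ i) a)‖ ≤ q * η := by
    refine (norm_sum_le_of_le (f := fun i => a - ρ (rootOfUnity M ^ i) a) (n := fun _ => η)
      _ fun i hi => ?_).trans (by simp)
    have hexp : rootOfUnity M ^ i = Circle.exp (i * (2 * Real.pi / M)) := by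
      rw [rootOfUnity, Circle.exp_natCast_mul]
    rw [hexp]
    refine hη _ (by positivity) ?_
    have hiq : (i : ℝ) < q := by exact_mod_cast Finset.mem_range.1 hi
    rw [hM, Nat.cast_mul]
    calc (i : ℝ) * (2 * Real.pi / (L * q)) = i / q * (2 * Real.pi / L) := by field_simp
      _ < 1 * (2 * Real.pi / L) := by
        gcongr
        rwa [div_lt_one hq']
      _ = _ := one_mul _
  have htotal : q * ‖a‖ ≤ q * (L * ‖gaugeAverage ρ M a‖ + η) := by
    calc q * ‖a‖ = ‖∑ i ∈ Finset.range q, a‖ := by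
          rw [Finset.sum_const, Finset.card_range, ← Nat.cast_smul_eq_nsmul ℂ, norm_smul,
            Complex.norm_natCast]
      _ = ‖∑ i ∈ Finset.range q, ρ (rootOfUnity M ^ i) a +
            ∑ i ∈ Finset.range q, (a - ρ (rootOfUnity M ^ i) a)‖ := by
          rw [← Finset.sum_add_distrib]; simp
      _ ≤ ‖∑ i ∈ Finset.range M, ρ (rootOfUnity M ^ i) a‖ + q * η :=
          (norm_add_le _ _).trans (add_le_add hmono hdiff)
      _ = q * (L * ‖gaugeAverage ρ M a‖ + η) := by
          rw [hsum, norm_smul, Complex.norm_natCast, hM, Nat.cast_mul]; ring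
  exact le_of_mul_le_mul_left htotal hq'

/-- A C*-algebra generated by a Cuntz family of at least two isometries that carries a gauge action
is simple. -/
theorem injective_of_gauge (h : IsCuntzFamily s) (hρ : ∀ z i, ρ z (s i) = (z : ℂ) • s i)
    (hdense : (StarAlgebra.adjoin ℂ (Set.range s)).topologicalClosure = ⊤) {i₀ i₁ : Fin n}
    (hi : i₀ ≠ i₁) {B : Type*} [CStarAlgebra B] [Nontrivial B] (φ : A →⋆ₐ[ℂ] B) :
    Function.Injective φ := by
  have hd : Dense ((⨆ p : ℕ × ℕ, wordSpan s p.1 p.2 : Submodule ℂ A) : Set A) := by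
    refine Dense.mono (s₁ := (StarAlgebra.adjoin ℂ (Set.range s) : Set A))
      (fun x hx => h.mem_iSup_wordSpan hx) ?_
    rw [dense_iff_closure_eq, ← StarSubalgebra.topologicalClosure_coe, hdense]
    rfl
  refine (injective_iff_map_eq_zero φ).2 fun b hb => ?_
  rw [← CStarRing.star_mul_self_eq_zero_iff, ← norm_le_zero_iff]
  set a := star b * b with ha
  have hφa : φ a = 0 := by rw [ha, map_mul, hb, mul_zero]
  -- `ρ` is not assumed to be a group action, so this is checked on polynomials and extended by
  -- continuity.
  have hone : ρ 1 a = a := by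
    have hc : IsClosed {x | ρ 1 x = x} := isClosed_eq
      (AddMonoidHomClass.continuous_of_bound (ρ 1) 1 fun x => by
        simpa using NonUnitalStarAlgHom.norm_apply_le (ρ 1) x) continuous_id
    have hsub : ((⨆ p : ℕ × ℕ, wordSpan s p.1 p.2 : Submodule ℂ A) : Set A) ⊆
        {x | ρ 1 x = x} := by
      intro x hx
      change x ∈ ⨆ p : ℕ × ℕ, wordSpan s p.1 p.2 at hx
      induction hx using Submodule.iSup_induction' with
      | mem p x hx => simp [gauge_apply hρ 1 hx]
      | zero => simp
      | add x y _ _ hx hy =>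
        simp only [Set.mem_ofPred_eq] at hx hy ⊢
        rw [map_add, hx, hy]
    exact hc.closure_subset_iff.2 hsub (hd a)
  refine le_of_forall_pos_le_add fun ε hε => ?_
  have hcont : Continuous fun t : ℝ => ‖a - ρ (Circle.exp t) a‖ :=
    (continuous_const.sub ((continuous_gauge hρ hd a).comp Circle.exp.continuous)).norm
  have h0 : ‖a - ρ (Circle.exp 0) a‖ < ε / 3 := by
    rw [Circle.exp_zero, hone, sub_self, norm_zero]; positivity
  obtain ⟨δ, hδ, hball⟩ := Metric.eventually_nhds_iff.1 (hcont.continuousAt.eventually_lt_const h0)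
  obtain ⟨L, hL⟩ := exists_nat_gt (2 * Real.pi / δ)
  have hL' : (0 : ℝ) < L := lt_trans (by positivity) hL
  -- The tolerance is divided by `L` because `norm_le_gaugeAverage` multiplies the average by `L`,
  -- which depends on `a` and `ε` only.
  obtain ⟨x, hxa, hx⟩ := Metric.dense_iff.1 hd a (ε / 3 / L) (by positivity)
  rw [Metric.mem_ball, dist_eq_norm] at hxa
  obtain ⟨N, hN⟩ := eventually_atTop.1 (h.eventually_norm_gaugeAverage_le hρ hi φ hx)
  have hLpos : 0 < L := by exact_mod_cast hL'
  -- With `q = N + 1`, the number of roots `L * q` is at least `N`, so the bound on averages of `x`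
  -- applies.
  have hmain := norm_le_gaugeAverage (ρ := ρ) (b := b) (η := ε / 3) hLpos N.succ_pos
    fun t ht htL => (hball (y := t) ?_).le
  · have hφx : ‖φ x‖ ≤ ε / 3 / L := by
      calc ‖φ x‖ = ‖φ (x - a)‖ := by rw [map_sub, hφa, sub_zero]
        _ ≤ ‖x - a‖ := NonUnitalStarAlgHom.norm_apply_le φ _
        _ ≤ _ := hxa.le
    have havg : ‖gaugeAverage ρ (L * N.succ) a‖ ≤ ε / 3 / L + ε / 3 / L := by
      calc ‖gaugeAverage ρ (L * N.succ) a‖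
          = ‖gaugeAverage ρ (L * N.succ) x - gaugeAverage ρ (L * N.succ) (x - a)‖ := by
            rw [← map_sub, sub_sub_cancel]
        _ ≤ ‖gaugeAverage ρ (L * N.succ) x‖ + ‖gaugeAverage ρ (L * N.succ) (x - a)‖ :=
            norm_sub_le _ _
        _ ≤ _ := add_le_add ((hN _ (by nlinarith)).trans hφx)
            ((norm_gaugeAverage_le _ _).trans hxa.le)
    calc ‖a‖ ≤ L * ‖gaugeAverage ρ (L * N.succ) a‖ + ε / 3 := hmain
      _ ≤ L * (ε / 3 / L + ε / 3 / L) + ε / 3 := by gcongr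
      _ = 0 + ε := by field_simp; ring
  · rw [Real.dist_eq, sub_zero, abs_of_nonneg ht]
    refine htL.trans ?_
    rw [div_lt_iff₀ hL']
    rwa [div_lt_iff₀ hδ, mul_comm (L : ℝ)] at hL

end Gauge

end IsCuntzFamily

/-! ### Gauge action, simplicity and uniqueness of the Cuntz algebra -/

namespace CuntzAlgebra

/-- The realization of the Cuntz relations with all generators multiplied by a phase. -/
def twistRealization {n : ℕ} (z : Circle) (r : CuntzRealization.{u} n) :
    CuntzRealization.{u} n where
  carrier := r.carrier
  gen i := (z : ℂ) • r.gen i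
  isCuntzFamily := by
    have hz : star (z : ℂ) * (z : ℂ) = 1 := by
      change starRingEnd ℂ z * (z : ℂ) = 1
      rw [mul_comm, Complex.mul_conj, Circle.normSq_coe, Complex.ofReal_one]
    constructor
    · intro i j
      rw [star_smul, smul_mul_smul_comm, hz, one_smul, r.isCuntzFamily.star_mul]
    · rw [← r.isCuntzFamily.sum_mul_star]
      refine Finset.sum_congr rfl fun i _ => ?_
      rw [star_smul, smul_mul_smul_comm, mul_comm, hz, one_smul]

/-- The gauge action on bounded families over all realizations of the Cuntz relations. -/
def productGauge {n : ℕ} (z : Circle) : CuntzProduct.{u} n →⋆ₐ[ℂ] CuntzProduct.{u} n where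
  toFun x := ⟨fun r => x (twistRealization z r), memℓp_infty
    ((memℓp_infty_iff.1 (lp.memℓp x)).mono (by
      rintro _ ⟨r, rfl⟩
      exact ⟨twistRealization z r, rfl⟩))⟩
  map_one' := rfl
  map_mul' _ _ := rfl
  map_zero' := rfl
  map_add' _ _ := rfl
  commutes' _ := rfl
  map_star' _ := rfl

/-- Reindexing the product by twisted realizations multiplies each canonical generator by `z`, hence
preserves the closed *-subalgebra that they generate. -/
theorem exists_gauge (n : ℕ) (z : Circle) :
    ∃ φ : CuntzAlgebra.{u} n →⋆ₐ[ℂ] CuntzAlgebra.{u} n, ∀ i, φ (gen n i) = (z : ℂ) • gen n i := by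
  have hcont : Continuous (productGauge.{u} (n := n) z) :=
    AddMonoidHomClass.continuous_of_bound _ 1 fun x => by
      simpa using NonUnitalStarAlgHom.norm_apply_le (productGauge z) x
  have hle : CuntzAlgebra.{u} n ≤ (CuntzAlgebra.{u} n).comap (productGauge z) := by
    refine StarSubalgebra.topologicalClosure_minimal ?_
      ((StarSubalgebra.isClosed_topologicalClosure _).preimage hcont)
    rw [StarAlgebra.adjoin_le_iff]
    rintro _ ⟨i, rfl⟩
    exact ((z : ℂ) • gen.{u} n i).2
  exact ⟨((productGauge z).comp (CuntzAlgebra.{u} n).subtype).codRestrict _ fun x => hle x.2,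
    fun i => rfl⟩

/-- For `n ≥ 2` the Cuntz algebra `𝓞ₙ` is simple: its unital *-homomorphisms to nonzero C*-algebras
are injective. -/
theorem injective_of_nontrivial {n : ℕ} (hn : 2 ≤ n) {B : Type v} [CStarAlgebra B] [Nontrivial B]
    (φ : CuntzAlgebra.{u} n →⋆ₐ[ℂ] B) : Function.Injective φ := by
  choose ρ hρ using exists_gauge.{u} n
  refine (isCuntzFamily_gen n).injective_of_gauge hρ (adjoin_gen n)
    (i₀ := ⟨0, by omega⟩) (i₁ := ⟨1, by omega⟩) ?_ φ
  simp

theorem nontrivial_of_isCuntzFamily {n : ℕ} {B : Type u} [CStarAlgebra B] [Nontrivial B]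
    {s : Fin n → B} (hs : IsCuntzFamily s) : Nontrivial (CuntzAlgebra.{u} n) := by
  obtain ⟨φ, -⟩ := (existsUnique_lift hs).exists
  exact φ.toRingHom.domain_nontrivial

/-- An injective *-homomorphism whose range contains the generators is surjective. -/
theorem surjective_of_injective {n : ℕ} {C : Type v} [CStarAlgebra C]
    (φ : C →⋆ₐ[ℂ] CuntzAlgebra.{u} n) (hφ : Function.Injective φ)
    (hgen : ∀ i, gen n i ∈ Set.range φ) : Function.Surjective φ := by
  have hclosed : IsClosed (φ.range : Set (CuntzAlgebra.{u} n)) := by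
    change IsClosed (Set.range φ)
    exact (NonUnitalStarAlgHom.isometry φ hφ).isClosedEmbedding.isClosed_range
  have hle : (StarAlgebra.adjoin ℂ (Set.range (gen.{u} n))).topologicalClosure ≤ φ.range := by
    refine StarSubalgebra.topologicalClosure_minimal ?_ hclosed
    rw [StarAlgebra.adjoin_le_iff]
    rintro _ ⟨i, rfl⟩
    exact hgen i
  rw [adjoin_gen] at hle
  exact fun y => hle (StarSubalgebra.mem_top (x := y))

open scoped CStarAlgebra in
/-- The C*-algebra generated by two isometries that satisfy the Cuntz relations is isomorphic
to `𝓞₂`. -/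
theorem nonempty_starAlgEquiv {H : Type v} [NormedAddCommGroup H] [InnerProductSpace ℂ H]
    [CompleteSpace H] [Nontrivial H] [Nontrivial (CuntzAlgebra.{u} 2)] {a b : H →L[ℂ] H}
    (h : IsCuntzFamily ![a, b]) :
    Nonempty (cstarGenerated {a, b} ≃⋆ₐ[ℂ] CuntzAlgebra.{u} 2) := by
  have hg := isCuntzFamily_gen.{u} 2
  -- The universal property reaches only one universe. The product lies in `max (u + 1) v`, and
  -- lifting to it gives homomorphisms `α`, `β` from a single Cuntz algebra to both sides.
  have hprod : IsCuntzFamily fun i => ((![a, b] i, gen.{u} 2 i) :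
      (H →L[ℂ] H) × CuntzAlgebra.{u} 2) := by
    constructor
    · intro i j
      refine Prod.ext ((h.star_mul i j).trans ?_) ((hg.star_mul i j).trans ?_) <;>
        split_ifs <;> rfl
    · refine Prod.ext ?_ ?_
      · rw [Prod.fst_sum]; exact h.sum_mul_star
      · rw [Prod.snd_sum]; exact hg.sum_mul_star
  obtain ⟨Φ, hΦ⟩ := (existsUnique_lift hprod).exists
  set α : CuntzAlgebra.{max (u + 1) v} 2 →⋆ₐ[ℂ] (H →L[ℂ] H) := (StarAlgHom.fst ℂ _ _).comp Φ
  set β : CuntzAlgebra.{max (u + 1) v} 2 →⋆ₐ[ℂ] CuntzAlgebra.{u} 2 := (StarAlgHom.snd ℂ _ _).comp Φ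
  have hα : ∀ i, α (gen 2 i) = ![a, b] i := fun i => congrArg Prod.fst (hΦ i)
  have hβ : ∀ i, β (gen 2 i) = gen 2 i := fun i => congrArg Prod.snd (hΦ i)
  have hαinj := injective_of_nontrivial le_rfl α
  have hβinj := injective_of_nontrivial le_rfl β
  have hmem_gen : ∀ i, ![a, b] i ∈ cstarGenerated {a, b} := by
    intro i
    refine NonUnitalStarSubalgebra.le_topologicalClosure _
      (NonUnitalStarAlgebra.subset_adjoin ℂ _ ?_)
    fin_cases i <;> simp
  -- The generated algebra is formed without a unit, but contains `1 = a* a`.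
  have hone : (1 : H →L[ℂ] H) ∈ cstarGenerated {a, b} := by
    have := h.star_mul 0 0
    rw [if_pos rfl] at this
    rw [← this]
    exact mul_mem (star_mem (hmem_gen 0)) (hmem_gen 0)
  have hαmem : ∀ x, α x ∈ cstarGenerated {a, b} := by
    have hadj : (StarAlgebra.adjoin ℂ (Set.range (gen.{max (u + 1) v} 2)) :
        Set (CuntzAlgebra.{max (u + 1) v} 2)) ⊆ {x | α x ∈ cstarGenerated {a, b}} := by
      intro x hx
      change x ∈ StarAlgebra.adjoin ℂ _ at hx
      change α x ∈ cstarGenerated {a, b}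
      induction hx using StarAlgebra.adjoin_induction with
      | mem x hx => obtain ⟨i, rfl⟩ := hx; rw [hα]; exact hmem_gen i
      | algebraMap c =>
        rw [AlgHomClass.commutes, Algebra.algebraMap_eq_smul_one]
        exact SMulMemClass.smul_mem c hone
      | add x y _ _ hx hy => rw [map_add]; exact add_mem hx hy
      | mul x y _ _ hx hy => rw [map_mul]; exact mul_mem hx hy
      | star x _ hx => rw [map_star]; exact star_mem hx
    have hclosed : IsClosed {x | α x ∈ cstarGenerated {a, b}} :=
      (NonUnitalStarSubalgebra.isClosed_topologicalClosure
        (NonUnitalStarAlgebra.adjoin ℂ {a, b})).preimage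
          (NonUnitalStarAlgHom.isometry α hαinj).continuous
    intro x
    refine hclosed.closure_subset_iff.2 hadj ?_
    rw [← StarSubalgebra.topologicalClosure_coe, adjoin_gen]
    exact StarSubalgebra.mem_top
  have hαsurj : cstarGenerated {a, b} ≤ NonUnitalStarAlgHom.range α := by
    refine NonUnitalStarSubalgebra.topologicalClosure_minimal _ ?_ ?_
    · refine NonUnitalStarAlgebra.adjoin_le ?_
      rintro _ (rfl | rfl)
      · exact ⟨_, hα 0⟩
      · exact ⟨_, hα 1⟩
    · rw [NonUnitalStarAlgHom.coe_range]
      exact (NonUnitalStarAlgHom.isometry α hαinj).isClosedEmbedding.isClosed_range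
  have hβbij : Function.Bijective β :=
    ⟨hβinj, surjective_of_injective β hβinj fun i => ⟨_, hβ i⟩⟩
  set α' : CuntzAlgebra.{max (u + 1) v} 2 →⋆ₙₐ[ℂ] cstarGenerated {a, b} :=
    NonUnitalStarAlgHom.codRestrict α (cstarGenerated {a, b}) hαmem
  have hα'bij : Function.Bijective α' := by
    refine ⟨fun x y hxy => hαinj (congrArg Subtype.val hxy), fun y => ?_⟩
    obtain ⟨x, hx⟩ := hαsurj y.2
    exact ⟨x, Subtype.ext hx⟩
  exact ⟨(StarAlgEquiv.ofBijective α' hα'bij).symm.trans (StarAlgEquiv.ofBijective β hβbij)⟩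

end CuntzAlgebra

/-! ### Nontriviality of `𝓞₂` and the conclusion -/

/-- The `ℓ²` space of a type in bijection with `ι` has a Hilbert basis indexed by `ι`. -/
theorem nonempty_hilbertBasis_lp {ι κ : Type*} (σ : ι ≃ κ) :
    Nonempty (HilbertBasis ι ℂ (lp (fun _ : κ => ℂ) 2)) := by
  set e : HilbertBasis κ ℂ (lp (fun _ : κ => ℂ) 2) := HilbertBasis.ofRepr (.refl ℂ _)
  refine ⟨HilbertBasis.mk (e.orthonormal.comp σ σ.injective) ?_⟩
  rw [σ.surjective.range_comp, e.dense_span]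

theorem HilbertBasis.nontrivial {ι H : Type*} [NormedAddCommGroup H] [InnerProductSpace ℂ H]
    [Nonempty ι] (e : HilbertBasis ι ℂ H) : Nontrivial H :=
  ⟨e (Classical.arbitrary ι), 0, e.orthonormal.ne_zero _⟩

namespace Collatz

instance : Nonempty Sec := ⟨⟨1, Or.inl (Or.inl rfl)⟩⟩

/-- The Collatz operators themselves give a nonzero realization; `ULift` places their Hilbert space
in universe `u`. -/
instance : Nontrivial (CuntzAlgebra.{u} 2) := by
  obtain ⟨e⟩ := nonempty_hilbertBasis_lp (Equiv.ulift.{u} (α := Sec)).symm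
  have := e.nontrivial
  exact CuntzAlgebra.nontrivial_of_isCuntzFamily (isCuntzFamily_S e)

end Collatz

theorem mainTheorem7 {H : Type v} [NormedAddCommGroup H] [InnerProductSpace ℂ H]
    [CompleteSpace H] (e : HilbertBasis Collatz.Sec ℂ H) :
    cstarGenerated {Collatz.S₁ e, Collatz.S₂ e} = cstarGenerated {Collatz.T₁ e, Collatz.T₂ e} ∧
    (∀ x : H, ‖Collatz.S₁ e x‖ = ‖x‖) ∧ (∀ x : H, ‖Collatz.S₂ e x‖ = ‖x‖) ∧
    IsCuntzFamily ![Collatz.S₁ e, Collatz.S₂ e] ∧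
    Nonempty (cstarGenerated {Collatz.S₁ e, Collatz.S₂ e} ≃⋆ₐ[ℂ] CuntzAlgebra.{u} 2) := by
  have h := Collatz.isCuntzFamily_S e
  have := e.nontrivial
  refine ⟨?_, norm_apply_eq_of_star_mul_self (h.star_mul 0 0),
    norm_apply_eq_of_star_mul_self (h.star_mul 1 1), h, CuntzAlgebra.nonempty_starAlgEquiv h⟩
  rw [cstarGenerated, cstarGenerated, Collatz.adjoin_S]
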